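/- Let $G=(V,E)$ be a finite simple undirected graph with edge costs $c:E\to[0,\infty)$, let $r\in V$ be a root, let $T\subseteq V\setminus\{r\}$ be a set of terminals, and let $k\ge 0$ be an integer. Two paths are called internally vertex-disjoint if no inner vertex of one of them lies on the other. A subgraph $H$ of $G$ is feasible if for every $t\in T$ it contains $k$ distinct pairwise internally vertex-disjoint paths from $t$ to $r$, and $\mathrm{OPT}$ denotes the minimum cost $\sum_{e\in E(H)}c(e)$ of a feasible subgraph $H$. For $t\in T$, an augmentation for $t$ with respect to $T\setminus\{t\}$ is a set of $k$ distinct pairwise internally vertex-disjoint paths in $G$, each from $t$ to some vertex of $(T\setminus\{t\})\cup\{r\}$, such that every terminal $t'\in T\setminus\{t\}$ is the endpoint of at most one of them (the root may be the endpoint of several). Let $\mathrm{AugCost}(t)$ be the minimum of the total cost of the paths over all augmentations for $t$ with respect to $T\setminus\{t\}$. (A minimum over the empty set is $\infty$.) Then $$\sum_{t\in T}\mathrm{AugCost}(t)\;\le\;8k\cdot\mathrm{OPT}.$$ In particular, if the instance has a feasible subgraph, then every terminal $t$ has an augmentation with respect to $T\setminus\{t\}$. -/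

import Mathlib

open scoped NNReal ENNReal

noncomputable section

namespace SSConn

variable {V : Type*}

/-- Two walks are internally vertex-disjoint: every vertex they have in common is an end of both,
that is, no inner vertex of one of them lies on the other. -/
def InternallyDisjoint {G : SimpleGraph V} {a b a' b' : V} (p : G.Walk a b) (q : G.Walk a' b') :
    Prop :=
  ∀ v, v ∈ p.support → v ∈ q.support → (v = a ∨ v = b) ∧ (v = a' ∨ v = b')

/-- The total cost of the edges of a walk (for a path, every edge is counted once). -/
def walkCost (c : Sym2 V → ℝ≥0) {G : SimpleGraph V} {a b : V} (p : G.Walk a b) : ℝ≥0 :=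
  (p.edges.map c).sum

open Classical in
/-- The total cost of the edges of a graph on a finite vertex set. -/
def graphCost [Fintype V] (c : Sym2 V → ℝ≥0) (H : SimpleGraph V) : ℝ≥0 :=
  ∑ e ∈ H.edgeFinset, c e

/-- `H` contains `k` (distinct) pairwise internally vertex-disjoint paths from `t` to `r`. -/
def HasDisjointPaths (H : SimpleGraph V) (k : ℕ) (t r : V) : Prop :=
  ∃ P : Finset (H.Walk t r), P.card = k ∧ (∀ p ∈ P, p.IsPath) ∧
    ∀ p ∈ P, ∀ q ∈ P, p ≠ q → InternallyDisjoint p q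

/-- `H` is a feasible solution of the single-sink `k`-vertex-connectivity instance with
graph `G`, root `r` and terminal set `T`. -/
def IsFeasible (G : SimpleGraph V) (k : ℕ) (r : V) (T : Finset V) (H : SimpleGraph V) : Prop :=
  H ≤ G ∧ ∀ t ∈ T, HasDisjointPaths H k t r

/-- The minimum cost of a feasible solution (`∞` if there is none). Vertices have no cost, so it
is enough to range over the subgraphs of `G` with the full vertex set. -/
def optCost [Fintype V] (G : SimpleGraph V) (c : Sym2 V → ℝ≥0) (k : ℕ) (r : V) (T : Finset V) :
    ℝ≥0∞ :=
  ⨅ (H : SimpleGraph V) (_ : IsFeasible G k r T H), (graphCost c H : ℝ≥0∞)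

/-- The set `P` of paths of `G` starting at `t` is an augmentation for `t` with respect to the
terminal set `T'`: it consists of `k` paths from `t` to `T' ∪ {r}` which are pairwise internally
vertex-disjoint, and every vertex of `T'` is the endpoint of at most one of them (whereas `r` may
be the endpoint of several). -/
structure IsAugmentation (G : SimpleGraph V) (k : ℕ) (r : V) (T' : Finset V) (t : V)
    (P : Finset (Σ v : V, G.Walk t v)) : Prop where
  card_eq : P.card = k
  isPath : ∀ p ∈ P, p.2.IsPath
  endpoint_mem : ∀ p ∈ P, p.1 ∈ T' ∨ p.1 = r
  disjoint : ∀ p ∈ P, ∀ q ∈ P, p ≠ q → InternallyDisjoint p.2 q.2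
  endpoint_unique : ∀ p ∈ P, ∀ q ∈ P, p.1 ∈ T' → p.1 = q.1 → p = q

/-- The minimum cost of an augmentation for `t` with respect to `T'` (`∞` if there is none). -/
def augCost (G : SimpleGraph V) (c : Sym2 V → ℝ≥0) (k : ℕ) (r : V) (T' : Finset V) (t : V) :
    ℝ≥0∞ :=
  ⨅ (P : Finset (Σ v : V, G.Walk t v)) (_ : IsAugmentation G k r T' t P),
    ((∑ p ∈ P, walkCost c p.2 : ℝ≥0) : ℝ≥0∞)

end SSConn

end

noncomputable section

namespace SSConn

variable {V : Type*}

/-! Fix a feasible `H`, a set `S ⊆ T`, and `D = S ∪ {r}`. The disjoint paths in `H` give a cut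
condition that counts vertices outside `D` and edges inside `D`. Edges outside `D` can be deleted or
contracted one by one without destroying it (`CutCondition.deleteEdges_or_contract`). What remains
are disjoint connected blobs such that every `t ∈ S` has, in total, at least `k` edges into `D` and
blobs shared with another vertex of `D`. A closed tour through each blob and its feet, of at most
twice the blob's cost, then provides every `t ∈ S` with `k` links to other vertices of `D`. The
links of one `t` meet only in `D`, and the links of all `t ∈ S` together cost at most `2 · cost(H)`
(`exists_links`).

The links of `t` need not form an augmentation, since they may collide in `S \ {t}`. Augmentations
are therefore encoded as permutations in an assignment problem (`Arc`, `augCost_le_permCost`). Let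
`σ_t` be a cheapest valid permutation, and let `τ_i` be the cycles obtained from the links. If `σ_t`
fixes `S \ {t}`, then `(k σ_t + ∑ τ_i - (k - 1) I) / (k + 1)` is doubly stochastic: outside `S \
{t}` at most one `τ_i` moves a given vertex, and on `S \ {t}` the copies of `σ_t` make up for the
subtracted identity. Birkhoff's theorem rounds this matrix to a valid permutation
(`exists_perm_of_combination`), and optimality gives `cost(σ_t) ≤ ∑ cost(τ_i)`.

Each `σ_t` moves at most `k` terminals other than `t`, since each of them ends a path. So the
digraph "`σ_t` moves `s`" can be coloured with `2k + 1` colours (`exists_coloring`), and within a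
colour class `S` every `σ_t` fixes `S \ {t}`. Each class contributes at most `2 · cost(H)`, hence
the sum is at most `(4k + 2) · cost(H)`, which is at most `8k · cost(H)` for `k ≥ 1`. -/

/-! ### Mixed vertex-edge cuts and their uncrossing -/

open Classical in
/-- The vertices outside `A` that have a neighbour in `A`. -/
def boundary [Fintype V] (Q : SimpleGraph V) (A : Finset V) : Finset V :=
  Finset.univ.filter fun v => v ∉ A ∧ ∃ u ∈ A, Q.Adj u v

lemma mem_boundary [Fintype V] {Q : SimpleGraph V} {A : Finset V} {v : V} :
    v ∈ boundary Q A ↔ v ∉ A ∧ ∃ u ∈ A, Q.Adj u v := by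
  simp [boundary]

open Classical in
/-- The edges of `F` with exactly one end in `A`. -/
def crossing [Fintype V] (F : SimpleGraph V) (A : Finset V) : Finset (Sym2 V) :=
  F.edgeFinset.filter fun z => (∃ u ∈ z, u ∈ A) ∧ ∃ v ∈ z, v ∉ A

lemma mem_crossing [Fintype V] {F : SimpleGraph V} {A : Finset V} {z : Sym2 V} :
    z ∈ crossing F A ↔ z ∈ F.edgeSet ∧ (∃ u ∈ z, u ∈ A) ∧ ∃ v ∈ z, v ∉ A := by
  classical
  simp [crossing]

lemma card_add_card_le_of_union_inter {α : Type*} [DecidableEq α] {X Y A B : Finset α}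
    (h₁ : X ∪ Y ⊆ A ∪ B) (h₂ : X ∩ Y ⊆ A ∩ B) : X.card + Y.card ≤ A.card + B.card := by
  rw [← Finset.card_union_add_card_inter X Y, ← Finset.card_union_add_card_inter A B]
  exact Nat.add_le_add (Finset.card_le_card h₁) (Finset.card_le_card h₂)

/-- The element `q` is counted twice on the right and at most once on the left. This is the source
of strictness in the uncrossing. -/
lemma card_add_card_lt_of_union_inter {α : Type*} [DecidableEq α] {X Y A B : Finset α} {q : α}
    (h₁ : X ∪ Y ⊆ A ∪ B) (h₂ : X ∩ Y ⊆ A ∩ B) (hq : q ∈ A ∩ B) (hq' : q ∉ X) :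
    X.card + Y.card < A.card + B.card := by
  rw [← Finset.card_union_add_card_inter X Y, ← Finset.card_union_add_card_inter A B]
  refine Nat.add_lt_add_of_le_of_lt (Finset.card_le_card h₁) (Finset.card_lt_card ?_)
  exact ⟨h₂, fun h => hq' (Finset.mem_inter.1 (h hq)).1⟩

lemma card_crossing_inter_union [Fintype V] [DecidableEq V] (F : SimpleGraph V) (A B : Finset V) :
    (crossing F (A ∩ B)).card + (crossing F (A ∪ B)).card ≤
      (crossing F A).card + (crossing F B).card := by
  apply card_add_card_le_of_union_inter
  all_goals
    intro z
    induction z with | _ a b =>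
    simp only [Finset.mem_union, Finset.mem_inter, mem_crossing, Sym2.mem_iff,
      exists_eq_or_imp, exists_eq_left]
    tauto

lemma card_crossing_sdiff [Fintype V] [DecidableEq V] (F : SimpleGraph V) (A B : Finset V) :
    (crossing F (A \ B)).card + (crossing F (B \ A)).card ≤
      (crossing F A).card + (crossing F B).card := by
  apply card_add_card_le_of_union_inter
  all_goals
    intro z
    induction z with | _ a b =>
    simp only [Finset.mem_union, Finset.mem_inter, mem_crossing, Sym2.mem_iff,
      exists_eq_or_imp, exists_eq_left, Finset.mem_sdiff]
    tauto

/-- If all edges of `F` have their ends in `D`, then `crossing F A` depends only on `A ∩ D`. -/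
lemma crossing_congr [Fintype V] {F : SimpleGraph V} {D A B : Finset V}
    (hF : ∀ u v, F.Adj u v → u ∈ D) (h : ∀ v ∈ D, v ∈ A ↔ v ∈ B) :
    crossing F A = crossing F B := by
  ext z
  induction z with | _ a b =>
  simp only [mem_crossing, Sym2.mem_iff, exists_eq_or_imp, exists_eq_left,
    SimpleGraph.mem_edgeSet]
  refine and_congr_right fun hab => ?_
  rw [h a (hF _ _ hab), h b (hF _ _ hab.symm)]

/-- Every set that contains a vertex of `S` but not `r`, and whose boundary in `Q` avoids `D`, is
left by at least `k` boundary vertices and edges of `F`. -/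
def CutCondition [Fintype V] (Q F : SimpleGraph V) (k : ℕ) (r : V) (S D : Finset V) : Prop :=
  ∀ A : Finset V, (∃ t ∈ S, t ∈ A) → r ∉ A → (∀ v ∈ boundary Q A, v ∉ D) →
    k ≤ (boundary Q A).card + (crossing F A).card

/-- The graph obtained from `Q` by contracting `q` into `p`; the vertex `q` becomes isolated. -/
def contract [DecidableEq V] (Q : SimpleGraph V) (p q : V) : SimpleGraph V where
  Adj u v := u ≠ v ∧ ∃ u' v', (if u' = q then p else u') = u ∧ (if v' = q then p else v') = v ∧
    Q.Adj u' v'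
  symm := ⟨by
    rintro u v ⟨h, u', v', hu, hv, h'⟩
    exact ⟨h.symm, v', u', hv, hu, h'.symm⟩⟩
  loopless := ⟨fun u h => h.1 rfl⟩

lemma boundary_deleteEdges [Fintype V] {Q : SimpleGraph V} {p q : V} {A : Finset V}
    (h : p ∈ A ↔ q ∈ A) : boundary (Q.deleteEdges {s(p, q)}) A = boundary Q A := by
  ext v
  simp only [mem_boundary, SimpleGraph.deleteEdges_adj, Set.mem_singleton_iff, Sym2.eq_iff]
  refine and_congr_right fun hv => exists_congr fun u => and_congr_right fun hu =>
    and_iff_left ?_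
  rintro (⟨rfl, rfl⟩ | ⟨rfl, rfl⟩) <;> tauto

/-- Uncrossing a cut that becomes too small when the edge `pq` is deleted with one that becomes
too small when `pq` is contracted. -/
lemma uncross [Fintype V] [DecidableEq V] {Q F : SimpleGraph V} {k : ℕ} {r : V} {S D : Finset V}
    (hSD : S ⊆ D) (hF : ∀ u v, F.Adj u v → u ∈ D) (hcut : CutCondition Q F k r S D)
    {p q : V} {A B : Finset V}
    (hA : ∃ t ∈ S, t ∈ A) (hrA : r ∉ A) (hAD : ∀ v ∈ boundary Q A, v ∉ D)
    (hAk : (boundary Q A).card + (crossing F A).card ≤ k)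
    (hB : ∃ t ∈ S, t ∈ B) (hrB : r ∉ B) (hBD : ∀ v ∈ boundary Q B, v ∉ D)
    (hBk : (boundary Q B).card + (crossing F B).card ≤ k)
    (hqA : q ∈ boundary Q A) (hqp : ∀ u ∈ A, Q.Adj u q → u = p)
    (hpB : p ∈ boundary Q B) (hqB : q ∈ boundary Q B) : False := by
  -- If `A ∩ B` contains a vertex of `S`, intersection and union are cuts to which `hcut` applies.
  -- Otherwise the two differences are used, with the opposite boundaries removed as well.
  by_cases hAB : ∃ t ∈ S, t ∈ A ∩ B
  · have h1 : (boundary Q (A ∩ B)).card + (boundary Q (A ∪ B)).card <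
        (boundary Q A).card + (boundary Q B).card := by
      refine card_add_card_lt_of_union_inter (q := q) ?_ ?_ (Finset.mem_inter.2 ⟨hqA, hqB⟩) ?_
      · intro v
        simp only [Finset.mem_union, mem_boundary, Finset.mem_inter]
        grind
      · intro v
        simp only [Finset.mem_union, mem_boundary, Finset.mem_inter]
        grind
      -- The only neighbour of `q` in `A` is `p`, which is not in `B`; so `q` drops out of the
      -- boundary of `A ∩ B`.
      · simp only [mem_boundary, Finset.mem_inter] at hpB ⊢
        rintro ⟨-, u, ⟨huA, huB⟩, hu⟩
        exact hpB.1 (hqp u huA hu ▸ huB)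
    have h2 := card_crossing_inter_union F A B
    have hD : ∀ v, v ∈ boundary Q (A ∩ B) ∨ v ∈ boundary Q (A ∪ B) → v ∉ D := by
      intro v hv
      have : v ∈ boundary Q A ∨ v ∈ boundary Q B := by
        simp only [Finset.mem_union, mem_boundary, Finset.mem_inter] at hv ⊢
        grind
      exact this.elim (hAD v) (hBD v)
    have h3 := hcut (A ∩ B) hAB (by simp [hrA]) fun v hv => hD v (Or.inl hv)
    obtain ⟨t, ht, htA⟩ := hA
    have h4 := hcut (A ∪ B) ⟨t, ht, by simp [htA]⟩ (by simp [hrA, hrB]) fun v hv => hD v (Or.inr hv)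
    omega
  · have h1 : (boundary Q (A \ (B ∪ boundary Q B))).card +
        (boundary Q (B \ (A ∪ boundary Q A))).card <
        (boundary Q A).card + (boundary Q B).card := by
      refine card_add_card_lt_of_union_inter (q := q) ?_ ?_ (Finset.mem_inter.2 ⟨hqA, hqB⟩) ?_
      · intro v
        simp only [Finset.mem_union, mem_boundary, Finset.mem_sdiff]
        grind [SimpleGraph.Adj.symm]
      · intro v
        simp only [Finset.mem_union, mem_boundary, Finset.mem_sdiff, Finset.mem_inter]
        grind [SimpleGraph.Adj.symm]
      · intro h
        obtain ⟨-, u, hu, huq⟩ := mem_boundary.1 h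
        simp only [Finset.mem_sdiff, Finset.mem_union, not_or] at hu
        exact hu.2.2 (hqp u hu.1 huq ▸ hpB)
    have hD : ∀ v, v ∈ boundary Q (A \ (B ∪ boundary Q B)) ∨
        v ∈ boundary Q (B \ (A ∪ boundary Q A)) → v ∉ D := by
      intro v hv
      have : v ∈ boundary Q A ∨ v ∈ boundary Q B := by
        simp only [Finset.mem_union, mem_boundary, Finset.mem_sdiff] at hv ⊢
        grind [SimpleGraph.Adj.symm]
      exact this.elim (hAD v) (hBD v)
    have h2 := card_crossing_sdiff F A B
    -- The boundaries avoid `D`, which contains all ends of `F`; removing them does not change the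
    -- crossing edges.
    rw [crossing_congr (B := A \ (B ∪ boundary Q B)) (A := A \ B) hF (fun v hv => by
        have := fun h => hBD v h hv
        simp only [Finset.mem_sdiff, Finset.mem_union]; tauto),
      crossing_congr (B := B \ (A ∪ boundary Q A)) (A := B \ A) hF (fun v hv => by
        have := fun h => hAD v h hv
        simp only [Finset.mem_sdiff, Finset.mem_union]; tauto)] at h2
    obtain ⟨t, ht, htA⟩ := hA
    obtain ⟨s, hs, hsB⟩ := hB
    have h3 := hcut (A \ (B ∪ boundary Q B)) ⟨t, ht, by
      have h1 := fun h => hBD t h (hSD ht)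
      have h2 : t ∉ B := fun h => hAB ⟨t, ht, by simp [htA, h]⟩
      simp only [Finset.mem_sdiff, Finset.mem_union]; tauto⟩ (by simp [hrA])
      fun v hv => hD v (Or.inl hv)
    have h4 := hcut (B \ (A ∪ boundary Q A)) ⟨s, hs, by
      have h1 := fun h => hAD s h (hSD hs)
      have h2 : s ∉ A := fun h => hAB ⟨s, hs, by simp [hsB, h]⟩
      simp only [Finset.mem_sdiff, Finset.mem_union]; tauto⟩ (by simp [hrB])
      fun v hv => hD v (Or.inr hv)
    omega

/-- The reduction step of Hind and Oellermann: for an edge `pq` outside `D`, deleting or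
contracting it preserves the cut condition. -/
lemma CutCondition.deleteEdges_or_contract [Fintype V] [DecidableEq V] {Q F : SimpleGraph V}
    {k : ℕ} {r : V} {S D : Finset V} (hSD : S ⊆ D) (hrD : r ∈ D) (hF : ∀ u v, F.Adj u v → u ∈ D)
    (hcut : CutCondition Q F k r S D) {p q : V} (hp : p ∉ D) (hq : q ∉ D) :
    CutCondition (Q.deleteEdges {s(p, q)}) F k r S D ∨ CutCondition (contract Q p q) F k r S D := by
  by_contra hcon
  rw [not_or] at hcon
  obtain ⟨h1, h2⟩ := hcon
  simp only [CutCondition, not_forall, not_le] at h1 h2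
  obtain ⟨A, hA, hrA, hAD, hAk⟩ := h1
  obtain ⟨B', hB', hrB', hBD', hBk'⟩ := h2
  -- the cut that is violated after the contraction
  have key : ∃ B : Finset V, (∃ t ∈ S, t ∈ B) ∧ r ∉ B ∧ (∀ v ∈ boundary Q B, v ∉ D) ∧
      (boundary Q B).card + (crossing F B).card ≤ k ∧ p ∈ boundary Q B ∧ q ∈ boundary Q B := by
    obtain ⟨f, hf⟩ : ∃ f : V → V, f = fun v => if v = q then p else v := ⟨_, rfl⟩
    have hfD : ∀ v ∈ D, f v = v := fun v hv => by
      rw [hf]; exact if_neg fun (h : v = q) => hq (h ▸ hv)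
    have hfp : ∀ v, v ≠ q → f v = v := fun v hv => by rw [hf]; exact if_neg hv
    have hfq : f q = p := by rw [hf]; exact if_pos rfl
    -- `B` is the preimage of the violated cut under the contraction map.
    obtain ⟨B, hBdef⟩ : ∃ B : Finset V, ∀ v, v ∈ B ↔ f v ∈ B' :=
      ⟨Finset.univ.filter fun v => f v ∈ B', by simp⟩
    have hmap : ∀ v ∈ boundary Q B, f v ∈ boundary (contract Q p q) B' := by
      intro v hv
      obtain ⟨hv, u, hu, huv⟩ := mem_boundary.1 hv
      rw [hBdef] at hv hu
      exact mem_boundary.2 ⟨hv, f u, hu, fun h => hv (h ▸ hu), u, v, by rw [hf], by rw [hf], huv⟩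
    have hB : ∃ t ∈ S, t ∈ B := by
      obtain ⟨t, ht, htB⟩ := hB'
      exact ⟨t, ht, by rwa [hBdef, hfD t (hSD ht)]⟩
    have hrB : r ∉ B := by rwa [hBdef, hfD r hrD]
    have hBD : ∀ v ∈ boundary Q B, v ∉ D := fun v hv hvD =>
      hBD' v (hfD v hvD ▸ hmap v hv) hvD
    have hcr : crossing F B = crossing F B' :=
      crossing_congr hF fun v hv => by rw [hBdef, hfD v hv]
    have hc := hcut B hB hrB hBD
    rw [hcr] at hc
    -- The contraction map identifies only `p` and `q`. Unless both lie on the boundary of `B`, it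
    -- is injective there, and the violated cut would already be violated in `Q`.
    have hpq' : p ∈ boundary Q B ∧ q ∈ boundary Q B := by
      by_contra hpq'
      have : (boundary Q B).card ≤ (boundary (contract Q p q) B').card := by
        refine Finset.card_le_card_of_injOn f hmap fun u hu v hv huv => ?_
        rw [Finset.mem_coe] at hu hv
        by_cases h1 : u = q
        · by_cases h2 : v = q
          · rw [h1, h2]
          · rw [h1, hfq, hfp v h2] at huv
            exact absurd ⟨huv ▸ hv, h1 ▸ hu⟩ hpq'
        · by_cases h2 : v = q
          · rw [h2, hfq, hfp u h1] at huv
            exact absurd ⟨huv ▸ hu, h2 ▸ hv⟩ hpq'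
          · rwa [hfp u h1, hfp v h2] at huv
      omega
    refine ⟨B, hB, hrB, hBD, ?_, hpq'.1, hpq'.2⟩
    rw [hcr]
    have hsub : boundary Q B ⊆ insert q (boundary (contract Q p q) B') := fun v hv => by
      by_cases h : v = q
      · simp [h]
      · exact Finset.mem_insert_of_mem (hfp v h ▸ hmap v hv)
    have := (Finset.card_le_card hsub).trans (Finset.card_insert_le _ _)
    omega
  obtain ⟨B, hB, hrB, hBD, hBk, hpB, hqB⟩ := key
  -- A violated cut must separate the ends of the deleted edge; the claim is stated for arbitrary `p
  -- q` because either end may be the one in `A`.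
  have key' : ∀ p q : V, p ∉ D → q ∉ D → p ∈ A → q ∉ A →
      (∀ v ∈ boundary (Q.deleteEdges {s(p, q)}) A, v ∉ D) → 
      (boundary (Q.deleteEdges {s(p, q)}) A).card + (crossing F A).card < k →
      p ∈ boundary Q B → q ∈ boundary Q B → False := by
    intro p q hp hq hpA hqA hAD hAk hpB hqB
    have hsub : boundary Q A ⊆ insert q (boundary (Q.deleteEdges {s(p, q)}) A) := by
      intro v hv
      simp only [Finset.mem_insert, mem_boundary, SimpleGraph.deleteEdges_adj,
        Set.mem_singleton_iff, Sym2.eq_iff] at hv ⊢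
      grind
    have hAD' : ∀ v ∈ boundary Q A, v ∉ D := by
      intro v hv
      rcases Finset.mem_insert.1 (hsub hv) with rfl | h
      · exact hq
      · exact hAD v h
    have hc := hcut A hA hrA hAD'
    have hcard := (Finset.card_le_card hsub).trans (Finset.card_insert_le _ _)
    have hq' : q ∉ boundary (Q.deleteEdges {s(p, q)}) A := fun h => by
      have := Finset.card_le_card hsub
      rw [Finset.insert_eq_of_mem h] at this
      omega
    have hqb : q ∈ boundary Q A := by
      by_contra h
      have : boundary Q A ⊆ boundary (Q.deleteEdges {s(p, q)}) A := fun v hv =>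
        (Finset.mem_insert.1 (hsub hv)).resolve_left fun e => h (e ▸ hv)
      have := Finset.card_le_card this
      omega
    refine uncross hSD hF hcut hA hrA hAD' (by omega) hB hrB hBD hBk hqb ?_ hpB hqB
    intro u hu huq
    by_contra hup
    apply hq'
    rw [mem_boundary]
    refine ⟨hqA, u, hu, ?_⟩
    simp only [SimpleGraph.deleteEdges_adj, Set.mem_singleton_iff, Sym2.eq_iff]
    exact ⟨huq, by grind⟩
  by_cases hpA : p ∈ A
  · by_cases hqA : q ∈ A
    · have : boundary Q A = boundary (Q.deleteEdges {s(p, q)}) A :=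
        (boundary_deleteEdges (by simp [hpA, hqA])).symm
      rw [← this] at hAk hAD
      have := hcut A hA hrA hAD
      omega
    · exact key' p q hp hq hpA hqA hAD hAk hpB hqB
  · by_cases hqA : q ∈ A
    · rw [Sym2.eq_swap] at hAD hAk
      exact key' q p hq hp hqA hpA hAD hAk hqB hpB
    · have : boundary Q A = boundary (Q.deleteEdges {s(p, q)}) A :=
        (boundary_deleteEdges (by simp [hpA, hqA])).symm
      rw [← this] at hAk hAD
      have := hcut A hA hrA hAD
      omega

/-! ### Decomposition into connected blobs -/

/-- Connectedness of `Q` on a vertex set, in terms of cuts. -/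
def ConnectedOn (Q : SimpleGraph V) (U : Set V) : Prop :=
  ∀ W ⊆ U, W.Nonempty → W ≠ U → ∃ u ∈ W, ∃ v ∈ U, v ∉ W ∧ Q.Adj u v

/-- The vertices outside `D` with label `x`. -/
def blob (D : Finset V) (g : V → V) (x : V) : Set V := {v | v ∉ D ∧ g v = x}

/-- `t` has a neighbour in `B`. -/
def Touches (Q : SimpleGraph V) (t : V) (B : Set V) : Prop := ∃ v ∈ B, Q.Adj t v

open Classical in
/-- The labels of those blobs that are adjacent to `t` and to another vertex of `D`. -/
def linkLabels [Fintype V] (Q : SimpleGraph V) (D : Finset V) (g : V → V) (t : V) : Finset V :=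
  Finset.univ.filter fun x => Touches Q t (blob D g x) ∧ ∃ s ∈ D, s ≠ t ∧ Touches Q s (blob D g x)

lemma mem_linkLabels [Fintype V] {Q : SimpleGraph V} {D : Finset V} {g : V → V} {t x : V} :
    x ∈ linkLabels Q D g t ↔
      Touches Q t (blob D g x) ∧ ∃ s ∈ D, s ≠ t ∧ Touches Q s (blob D g x) := by
  simp [linkLabels]

lemma ConnectedOn.mono {Q Q' : SimpleGraph V} (h : Q ≤ Q') {U : Set V} (hU : ConnectedOn Q U) :
    ConnectedOn Q' U := fun W hW hne hWU =>
  let ⟨u, hu, v, hv, hvW, huv⟩ := hU W hW hne hWU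
  ⟨u, hu, v, hv, hvW, h huv⟩

lemma Touches.mono {Q Q' : SimpleGraph V} (h : Q ≤ Q') {t : V} {B : Set V} (hB : Touches Q t B) :
    Touches Q' t B :=
  let ⟨v, hv, htv⟩ := hB
  ⟨v, hv, h htv⟩

/-- If every two adjacent vertices have an end in `D`, then single vertices can serve as blobs. -/
lemma CutCondition.le_card_linkLabels_id [Fintype V] [DecidableEq V] {Q F : SimpleGraph V}
    {k : ℕ} {r : V} {S D : Finset V} (hSD : S ⊆ D) (hrS : r ∉ S) (hrD : r ∈ D)
    (hF : ∀ u v, F.Adj u v → u ∈ D) (hQD : ∀ u ∈ D, ∀ v ∈ D, ¬ Q.Adj u v)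
    (hcut : CutCondition Q F k r S D) (hindep : ∀ u v, u ∉ D → v ∉ D → ¬ Q.Adj u v)
    {t : V} (ht : t ∈ S) : k ≤ (linkLabels Q D id t).card + (crossing F {t}).card := by
  classical
  -- The cut consists of `t` and its private neighbours. Its boundary contains only neighbours of
  -- `t` shared with another vertex of `D`, each of which is a link label.
  obtain ⟨A, hA⟩ : ∃ A : Finset V, ∀ v, v ∈ A ↔ v = t ∨ (v ∉ D ∧ Q.Adj t v ∧
      ∀ s ∈ D, s ≠ t → ¬ Q.Adj s v) :=
    ⟨Finset.univ.filter fun v => v = t ∨ (v ∉ D ∧ Q.Adj t v ∧ ∀ s ∈ D, s ≠ t → ¬ Q.Adj s v),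
      by simp⟩
  have htD := hSD ht
  have hsub : ∀ v ∈ boundary Q A, v ∉ D ∧ v ∈ linkLabels Q D id t := by
    intro v hv
    obtain ⟨hvA, u, hu, huv⟩ := mem_boundary.1 hv
    rw [hA] at hvA hu
    have hut : u = t := by
      rcases hu with h | ⟨h1, h2, h3⟩
      · exact h
      · by_cases hvD : v ∈ D
        · by_cases hvt : v = t
          · exact absurd (Or.inl hvt) hvA
          · exact absurd huv.symm (h3 v hvD hvt)
        · exact absurd huv (hindep u v h1 hvD)
    subst hut
    have hvD : v ∉ D := fun h => hQD u htD v h huv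
    refine ⟨hvD, mem_linkLabels.2 ⟨⟨v, ⟨hvD, rfl⟩, huv⟩, ?_⟩⟩
    by_contra hcon
    refine hvA (Or.inr ⟨hvD, huv, fun s hs hsu hsv => hcon ⟨s, hs, hsu, v, ⟨hvD, rfl⟩, hsv⟩⟩)
  have h := hcut A ⟨t, ht, (hA t).2 (Or.inl rfl)⟩
    (fun h => by
      rcases (hA r).1 h with h | h
      · exact hrS (h ▸ ht)
      · exact h.1 hrD) fun v hv => (hsub v hv).1
  rw [crossing_congr (A := A) (B := {t}) hF fun v hv => by
    rw [hA, Finset.mem_singleton]; tauto] at h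
  have := Finset.card_le_card fun v hv => (hsub v hv).2
  omega

lemma ncard_edgeSet_contract_lt [Finite V] [DecidableEq V] {Q : SimpleGraph V} {p q : V}
    (hpq : Q.Adj p q) : (contract Q p q).edgeSet.ncard < Q.edgeSet.ncard := by
  have hsub : (contract Q p q).edgeSet ⊆
      Sym2.map (fun v => if v = q then p else v) '' (Q.edgeSet \ {s(p, q)}) := by
    intro z
    induction z with | _ a b =>
    rintro ⟨hab, u, v, hu, hv, huv⟩
    refine ⟨s(u, v), ⟨huv, fun h => hab ?_⟩, by simp [hu, hv]⟩
    rw [← hu, ← hv]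
    rcases Sym2.eq_iff.1 (Set.mem_singleton_iff.1 h) with ⟨rfl, rfl⟩ | ⟨rfl, rfl⟩ <;> simp
  calc _ ≤ _ := Set.ncard_le_ncard hsub (Set.toFinite _)
    _ ≤ _ := Set.ncard_image_le (Set.toFinite _)
    _ < _ := Set.ncard_sdiff_singleton_lt_of_mem hpq (Set.toFinite _)

/-- A part of the lifted blob that no edge leaves contains both or neither of `p` and `q`, which are
adjacent and carry the same label. It is therefore saturated for the contraction map, and its image
would disconnect the contracted blob. -/
lemma ConnectedOn.of_contract [DecidableEq V] {Q : SimpleGraph V} {D : Finset V} {p q : V}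
    (hp : p ∉ D) (hq : q ∉ D) (hpq : Q.Adj p q) {g : V → V} {x : V}
    (h : ConnectedOn (contract Q p q) (blob D g x)) :
    ConnectedOn Q (blob D (fun v => g (if v = q then p else v)) x) := by
  obtain ⟨f, hf⟩ : ∃ f : V → V, f = fun v => if v = q then p else v := ⟨_, rfl⟩
  have hfp : ∀ v, v ≠ q → f v = v := fun v hv => by rw [hf]; exact if_neg hv
  have hfq : f q = p := by rw [hf]; exact if_pos rfl
  have hfD : ∀ v, v ∉ D → f v ∉ D := fun v hv => by
    by_cases h : v = q
    · rwa [h, hfq]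
    · rwa [hfp v h]
  have hb : blob D (fun v => g (if v = q then p else v)) x = {v | v ∉ D ∧ g (f v) = x} := by
    rw [hf]; rfl
  rw [hb]
  intro W hW hne hWU
  by_contra hcon
  have hcon' : ∀ u ∈ W, ∀ v, v ∉ D → g (f v) = x → Q.Adj u v → v ∈ W := fun u hu v hvD hv huv => by
    by_contra hvW
    exact hcon ⟨u, hu, v, ⟨hvD, hv⟩, hvW, huv⟩
  have hpqW : p ∈ W ↔ q ∈ W := by
    constructor
    · intro h
      have := (hW h).2
      rw [hfp p hpq.ne] at this
      exact hcon' p h q hq (by rwa [hfq]) hpq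
    · intro h
      have := (hW h).2
      rw [hfq] at this
      exact hcon' q h p hp (by rwa [hfp p hpq.ne]) hpq.symm
  have hfW : ∀ v, v ∈ W ↔ f v ∈ W := fun v => by
    by_cases h : v = q
    · rw [h, hfq, hpqW]
    · rw [hfp v h]
  have hff : ∀ v, f (f v) = f v := fun v => by
    by_cases h : v = q
    · rw [h, hfq, hfp p hpq.ne]
    · rw [hfp v h, hfp v h]
  have hqf : ∀ v, f v ≠ q := fun v => by
    by_cases h : v = q
    · rw [h, hfq]; exact hpq.ne
    · rwa [hfp v h]
  obtain ⟨w, hw⟩ := hne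
  obtain ⟨y, hy, hyW⟩ : ∃ y ∈ {v | v ∉ D ∧ g (f v) = x}, y ∉ W := by
    by_contra h
    push Not at h
    exact hWU (hW.antisymm h)
  obtain ⟨_, ⟨⟨u, hu, rfl⟩, -⟩, v, hv, hvW, huv, u', v', hu', hv', huv'⟩ :=
    h ((f '' W) ∩ blob D g x) Set.inter_subset_right
      ⟨f w, ⟨w, hw, rfl⟩, hfD w (hW hw).1, (hW hw).2⟩ (fun h => hyW (by
        have : f y ∈ (f '' W) ∩ blob D g x := h.symm ▸ (⟨hfD y hy.1, hy.2⟩ : f y ∈ blob D g x)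
        obtain ⟨⟨z, hz, hzy⟩, -⟩ := this
        rw [hfW, ← hzy, ← hfW]
        exact hz))
  have e1 : f u' = f u := by rw [← hu', hf]
  have e2 : f v' = v := by rw [← hv', hf]
  have hu'W : u' ∈ W := by rw [hfW, e1, ← hfW]; exact hu
  refine hvW ⟨⟨v', hcon' u' hu'W v' ?_ ?_ huv', e2⟩, hv⟩
  · intro h
    have : v' ≠ q := fun h' => hq (h' ▸ h)
    rw [hfp v' this] at e2
    exact hv.1 (e2 ▸ h)
  · rw [e2]; exact hv.2

lemma Touches.of_contract [DecidableEq V] {Q : SimpleGraph V} {D : Finset V} {p q : V}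
    (hp : p ∉ D) (hq : q ∉ D) {g : V → V} {x t : V} (ht : t ∈ D)
    (h : Touches (contract Q p q) t (blob D g x)) :
    Touches Q t (blob D (fun v => g (if v = q then p else v)) x) := by
  obtain ⟨v, ⟨hvD, hv⟩, -, u', v', hu', hv', huv⟩ := h
  have hu : u' = t := by
    by_cases h : u' = q
    · rw [if_pos h] at hu'
      exact absurd (hu' ▸ ht) hp
    · rwa [if_neg h] at hu'
  subst hu
  refine ⟨v', ⟨fun h => hvD ?_, by simpa only [hv'] using hv⟩, huv⟩
  rwa [← hv', if_neg fun e : v' = q => hq (e ▸ h)]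

/-- Decomposition into disjoint connected blobs outside `D`: every `t ∈ S` is adjacent to many
blobs that are also adjacent to another vertex of `D`. -/
theorem CutCondition.exists_blobs [Fintype V] [DecidableEq V] {F Q : SimpleGraph V}
    {k : ℕ} {r : V} {S D : Finset V} (hSD : S ⊆ D) (hrS : r ∉ S) (hrD : r ∈ D)
    (hF : ∀ u v, F.Adj u v → u ∈ D) (hQD : ∀ u ∈ D, ∀ v ∈ D, ¬ Q.Adj u v)
    (hcut : CutCondition Q F k r S D) :
    ∃ g : V → V, (∀ x, ConnectedOn Q (blob D g x)) ∧
      ∀ t ∈ S, k ≤ (linkLabels Q D g t).card + (crossing F {t}).card := by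
  -- Both reductions lose an edge. Blobs found after a deletion remain blobs, and those found after
  -- a contraction are pulled back along the contraction map.
  induction hn : Q.edgeSet.ncard using Nat.strong_induction_on generalizing Q with
  | _ n ih =>
  by_cases hindep : ∀ u v, u ∉ D → v ∉ D → ¬ Q.Adj u v
  · refine ⟨id, fun x W hW hne hWU => ?_, fun t ht =>
      hcut.le_card_linkLabels_id hSD hrS hrD hF hQD hindep ht⟩
    obtain ⟨w, hw⟩ := hne
    refine absurd (hW.antisymm fun v hv => ?_) hWU
    have : v = w := hv.2.trans (hW hw).2.symm
    rwa [this]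
  · push Not at hindep
    obtain ⟨p, q, hp, hq, hpq⟩ := hindep
    rcases hcut.deleteEdges_or_contract hSD hrD hF hp hq with h | h
    · have hle : Q.deleteEdges {s(p, q)} ≤ Q := SimpleGraph.deleteEdges_le _
      obtain ⟨g, hg, hgS⟩ := ih _ (by
        rw [← hn, SimpleGraph.edgeSet_deleteEdges]
        exact Set.ncard_sdiff_singleton_lt_of_mem hpq (Set.toFinite _))
        (fun u hu v hv h => hQD u hu v hv (hle h)) h rfl
      refine ⟨g, fun x => (hg x).mono hle, fun t ht => (hgS t ht).trans ?_⟩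
      refine Nat.add_le_add_right (Finset.card_le_card fun x hx => ?_) _
      obtain ⟨h1, s, hs, hst, h2⟩ := mem_linkLabels.1 hx
      exact mem_linkLabels.2 ⟨h1.mono hle, s, hs, hst, h2.mono hle⟩
    · obtain ⟨g, hg, hgS⟩ := ih _ (hn ▸ ncard_edgeSet_contract_lt hpq)
        (fun u hu v hv h => by
          obtain ⟨-, u', v', hu', hv', huv⟩ := h
          have : ∀ w w', (if w' = q then p else w') = w → w ∈ D → w' = w := fun w w' h hw => by
            by_cases e : w' = q
            · rw [if_pos e] at h
              exact absurd (h ▸ hw) hp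
            · rwa [if_neg e] at h
          rw [this u u' hu' hu, this v v' hv' hv] at huv
          exact hQD u hu v hv huv) h rfl
      refine ⟨_, fun x => (hg x).of_contract hp hq hpq, fun t ht => (hgS t ht).trans ?_⟩
      refine Nat.add_le_add_right (Finset.card_le_card fun x hx => ?_) _
      obtain ⟨h1, s, hs, hst, h2⟩ := mem_linkLabels.1 hx
      exact mem_linkLabels.2
        ⟨h1.of_contract hp hq (hSD ht), s, hs, hst, h2.of_contract hp hq hs⟩

/-! ### Tours in connected sets -/

lemma walkCost_nil (c : Sym2 V → ℝ≥0) {G : SimpleGraph V} (a : V) :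
    walkCost c (SimpleGraph.Walk.nil : G.Walk a a) = 0 := by
  simp [walkCost]

lemma walkCost_cons (c : Sym2 V → ℝ≥0) {G : SimpleGraph V} {a b d : V} (h : G.Adj a b)
    (p : G.Walk b d) : walkCost c (.cons h p) = c s(a, b) + walkCost c p := by
  simp [walkCost]

lemma walkCost_append (c : Sym2 V → ℝ≥0) {G : SimpleGraph V} {a b d : V} (p : G.Walk a b)
    (q : G.Walk b d) : walkCost c (p.append q) = walkCost c p + walkCost c q := by
  simp [walkCost]

open Classical in
/-- The sum of the edge costs over all ordered pairs of adjacent vertices in `U`: every edge inside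
`U` is counted twice. -/
def pairCost (c : Sym2 V → ℝ≥0) (K : SimpleGraph V) (U : Finset V) : ℝ≥0 :=
  ∑ u ∈ U, ∑ v ∈ U, if K.Adj u v then c s(u, v) else 0

lemma pairCost_insert_ge [DecidableEq V] (c : Sym2 V → ℝ≥0) {K : SimpleGraph V} {U : Finset V}
    {u v : V} (hu : u ∈ U) (hv : v ∉ U) (huv : K.Adj u v) :
    pairCost c K U + c s(u, v) + c s(u, v) ≤ pairCost c K (insert v U) := by
  classical
  rw [pairCost, pairCost, Finset.sum_insert hv]
  have h1 : c s(u, v) ≤ ∑ w ∈ insert v U, if K.Adj v w then c s(v, w) else 0 := by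
    refine le_trans ?_ (Finset.single_le_sum (f := fun w => if K.Adj v w then c s(v, w) else 0)
      (fun _ _ => zero_le) (Finset.mem_insert_of_mem hu))
    rw [if_pos huv.symm, Sym2.eq_swap]
  have h2 : (∑ x ∈ U, ∑ y ∈ U, if K.Adj x y then c s(x, y) else 0) + c s(u, v) ≤
      ∑ x ∈ U, ∑ y ∈ insert v U, if K.Adj x y then c s(x, y) else 0 := by
    simp_rw [Finset.sum_insert hv]
    rw [Finset.sum_add_distrib, add_comm]
    refine add_le_add_left (le_trans ?_ (Finset.single_le_sum
      (f := fun w => if K.Adj w v then c s(w, v) else 0) (fun _ _ => zero_le) hu)) _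
    rw [if_pos huv]
  calc _ = c s(u, v) + ((∑ x ∈ U, ∑ y ∈ U, if K.Adj x y then c s(x, y) else 0) + c s(u, v)) := by
        ring
    _ ≤ _ := add_le_add h1 h2

/-- A permutation of the marked set `M` without fixed points (if `M` has two elements or more),
with walks inside `U` from every mark to its image, of total cost at most `C`. -/
def HasTour (c : Sym2 V → ℝ≥0) (K : SimpleGraph V) (U M : Finset V) (C : ℝ≥0) : Prop :=
  ∃ (π : Equiv.Perm V) (d : V → ℝ≥0), (∀ x, x ∉ M → π x = x) ∧ (∀ x ∈ M, π x ∈ M) ∧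
    (2 ≤ M.card → ∀ x ∈ M, π x ≠ x) ∧
    (∀ x ∈ M, ∃ q : K.Walk x (π x), (∀ v ∈ q.support, v ∈ U) ∧ walkCost c q ≤ d x) ∧
    ∑ x ∈ M, d x ≤ C

lemma HasTour.mono {c : Sym2 V → ℝ≥0} {K : SimpleGraph V} {U U' M : Finset V} {C C' : ℝ≥0}
    (h : HasTour c K U M C) (hU : U ⊆ U') (hC : C ≤ C') : HasTour c K U' M C' := by
  obtain ⟨π, d, h1, h2, h3, h4, h5⟩ := h
  refine ⟨π, d, h1, h2, h3, fun x hx => ?_, h5.trans hC⟩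
  obtain ⟨q, hq, hqd⟩ := h4 x hx
  exact ⟨q, fun v hv => hU (hq v hv), hqd⟩

/-- A tour of `M \ {v}` through the neighbour `u` of `v` extends to a tour of `M`. -/
lemma HasTour.insert_of_mem [DecidableEq V] {c : Sym2 V → ℝ≥0} {K : SimpleGraph V} {U M : Finset V}
    {C : ℝ≥0} {u v : V} (hu : u ∈ M) (hv : v ∉ M) (hMU : M ⊆ U) (huv : K.Adj u v)
    (h : HasTour c K U M C) :
    HasTour c K (insert v U) (insert v M) (C + c s(u, v) + c s(u, v)) := by
  obtain ⟨π, d, h1, h2, h3, h4, h5⟩ := h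
  have huv' : u ≠ v := huv.ne
  have hπv := h1 v hv
  have hπM : ∀ x ∈ M, π x ≠ v := fun x hx h => hv (h ▸ h2 x hx)
  -- The new mark is spliced in just before `u`: `v` goes to `u`, and the former predecessor of `u`
  -- goes to `v`. Each of these two uses the edge `uv` once.
  refine ⟨Equiv.swap u v * π, fun x => (if x = v then c s(u, v) else d x) +
    (if x = π⁻¹ u then c s(u, v) else 0), ?_, ?_, ?_, ?_, ?_⟩
  · intro x hx
    rw [Finset.mem_insert, not_or] at hx
    rw [Equiv.Perm.mul_apply, h1 x hx.2, Equiv.swap_apply_of_ne_of_ne (ne_of_mem_of_not_mem hu hx.2).symm hx.1]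
  · intro x hx
    rw [Equiv.Perm.mul_apply]
    rcases Finset.mem_insert.1 hx with rfl | hx
    · rw [hπv, Equiv.swap_apply_right]; exact Finset.mem_insert_of_mem hu
    · by_cases h : π x = u
      · rw [h, Equiv.swap_apply_left]; exact Finset.mem_insert_self _ _
      · rw [Equiv.swap_apply_of_ne_of_ne h (hπM x hx)]
        exact Finset.mem_insert_of_mem (h2 x hx)
  · intro _ x hx
    rw [Equiv.Perm.mul_apply]
    rcases Finset.mem_insert.1 hx with rfl | hx
    · rwa [hπv, Equiv.swap_apply_right]
    · by_cases h : π x = u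
      · rw [h, Equiv.swap_apply_left]; rintro rfl; exact hv hx
      · rw [Equiv.swap_apply_of_ne_of_ne h (hπM x hx)]
        by_cases hc : 2 ≤ M.card
        · exact h3 hc x hx
        · exact absurd (Finset.card_le_one.1 (by omega) _ (h2 x hx) _ hu) h
  · intro x hx
    rcases Finset.mem_insert.1 hx with rfl | hx
    · rw [Equiv.Perm.mul_apply, hπv, Equiv.swap_apply_right]
      refine ⟨.cons huv.symm .nil, by simp [hMU hu], ?_⟩
      dsimp only
      rw [walkCost_cons, walkCost_nil, add_zero, if_pos rfl, Sym2.eq_swap]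
      exact le_self_add
    · obtain ⟨q, hq, hqd⟩ := h4 x hx
      have hxv : x ≠ v := ne_of_mem_of_not_mem hx hv
      have hq' : ∀ w ∈ q.support, w ∈ insert v U := fun w hw => Finset.mem_insert_of_mem (hq w hw)
      dsimp only
      rw [Equiv.Perm.mul_apply, if_neg hxv]
      by_cases h : π x = u
      · rw [if_pos (Equiv.Perm.eq_inv_iff_eq.2 h), h, Equiv.swap_apply_left]
        have hadj : K.Adj (π x) v := h ▸ huv
        refine ⟨q.append (.cons hadj .nil), fun w hw => ?_, ?_⟩
        · rcases (SimpleGraph.Walk.mem_support_append_iff _ _).1 hw with hw | hw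
          · exact hq' w hw
          · simp only [SimpleGraph.Walk.support_cons, SimpleGraph.Walk.support_nil, List.mem_cons,
              List.not_mem_nil, or_false] at hw
            rcases hw with rfl | rfl
            · exact hq' _ q.end_mem_support
            · exact Finset.mem_insert_self _ _
        · have e : c s(π x, v) = c s(u, v) := by rw [h]
          rw [walkCost_append, walkCost_cons, walkCost_nil, add_zero, e]
          exact add_le_add_left hqd _
      · rw [Equiv.swap_apply_of_ne_of_ne h (hπM x hx)]
        exact ⟨q, hq', hqd.trans le_self_add⟩
  · rw [Finset.sum_add_distrib]
    refine add_le_add ?_ ?_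
    · rw [Finset.sum_insert hv, if_pos rfl, add_comm]
      refine add_le_add_left (le_trans (le_of_eq (Finset.sum_congr rfl fun x hx => ?_)) h5) _
      exact if_neg (ne_of_mem_of_not_mem hx hv)
    · rw [Finset.sum_ite_eq']
      split_ifs <;> simp

/-- A tour in which `u` is marked turns into a tour in which its neighbour `v` is marked
instead. -/
lemma HasTour.replace [DecidableEq V] {c : Sym2 V → ℝ≥0} {K : SimpleGraph V} {U M : Finset V}
    {C : ℝ≥0} {u v : V} (hu : u ∉ M) (hv : v ∉ M) (hvU : v ∉ U) (huv : K.Adj u v)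
    (h : HasTour c K U (insert u M) C) :
    HasTour c K (insert v U) (insert v M) (C + c s(u, v) + c s(u, v)) := by
  obtain ⟨π, d, h1, h2, h3, h4, h5⟩ := h
  have huv' : u ≠ v := huv.ne
  have hvM : v ∉ insert u M := by simp [hv, huv'.symm]
  have hπv := h1 v hvM
  have hπM : ∀ x ∈ insert u M, π x ≠ v := fun x hx h => hvM (h ▸ h2 x hx)
  have huM : u ∈ insert u M := Finset.mem_insert_self _ _
  have hcard : (insert u M).card = (insert v M).card := by
    rw [Finset.card_insert_of_notMem hu, Finset.card_insert_of_notMem hv]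
  -- the vertex of the old tour that corresponds to a mark of the new one
  have hs : ∀ x ∈ insert v M, Equiv.swap u v x ∈ insert u M := fun x hx => by
    rcases Finset.mem_insert.1 hx with rfl | hx
    · rw [Equiv.swap_apply_right]; exact huM
    · rw [Equiv.swap_apply_of_ne_of_ne (ne_of_mem_of_not_mem hx hu) (ne_of_mem_of_not_mem hx hv)]
      exact Finset.mem_insert_of_mem hx
  have hs' : ∀ x ∈ insert u M, Equiv.swap u v x ∈ insert v M := fun x hx => by
    rcases Finset.mem_insert.1 hx with rfl | hx
    · rw [Equiv.swap_apply_left]; exact Finset.mem_insert_self _ _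
    · rw [Equiv.swap_apply_of_ne_of_ne (ne_of_mem_of_not_mem hx hu) (ne_of_mem_of_not_mem hx hv)]
      exact Finset.mem_insert_of_mem hx
  have huU : ∀ x ∈ insert u M, π x = u → u ∈ U := fun x hx h => by
    obtain ⟨q, hq, -⟩ := h4 x hx
    exact h ▸ hq _ q.end_mem_support
  -- Conjugation renames the mark `u` to `v`; the edge `uv` is paid once on leaving `v` and once on
  -- returning to it.
  refine ⟨Equiv.swap u v * π * Equiv.swap u v, fun x => (d (Equiv.swap u v x) +
    if x = v then c s(u, v) else 0) +
    (if Equiv.swap u v x = π⁻¹ u then c s(u, v) else 0), ?_, ?_, ?_, ?_, ?_⟩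
  · intro x hx
    rw [Equiv.Perm.mul_apply, Equiv.Perm.mul_apply, h1, Equiv.swap_apply_self]
    intro h
    have := hs' _ h
    rw [Equiv.swap_apply_self] at this
    exact hx this
  · intro x hx
    exact hs' _ (h2 _ (hs x hx))
  · intro hc x hx h
    rw [Equiv.Perm.mul_apply, Equiv.Perm.mul_apply, Equiv.swap_apply_eq_iff] at h
    exact h3 (hcard ▸ hc) _ (hs x hx) h
  · intro x hx
    obtain ⟨y, hy⟩ : ∃ y, y = Equiv.swap u v x := ⟨_, rfl⟩
    have hyM : y ∈ insert u M := hy ▸ hs x hx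
    -- the first and the last step
    have first : ∃ q : K.Walk x y, (∀ w ∈ q.support, w = x ∨ w = y) ∧
        walkCost c q ≤ if x = v then c s(u, v) else 0 := by
      rcases Finset.mem_insert.1 hx with h | hx
      · rw [h, Equiv.swap_apply_right] at hy
        subst h hy
        refine ⟨.cons huv.symm .nil, by simp, ?_⟩
        rw [walkCost_cons, walkCost_nil, add_zero, if_pos rfl, Sym2.eq_swap]
      · rw [Equiv.swap_apply_of_ne_of_ne (ne_of_mem_of_not_mem hx hu) (ne_of_mem_of_not_mem hx hv)] at hy
        subst hy
        exact ⟨.nil, by simp, by simp [walkCost_nil]⟩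
    have last : ∃ q : K.Walk (π y) (Equiv.swap u v (π y)),
        (∀ w ∈ q.support, w = π y ∨ w = v) ∧
        walkCost c q ≤ if y = π⁻¹ u then c s(u, v) else 0 := by
      by_cases h : π y = u
      · rw [h, Equiv.swap_apply_left]
        refine ⟨.cons huv .nil, by simp, ?_⟩
        rw [walkCost_cons, walkCost_nil, add_zero, if_pos (Equiv.Perm.eq_inv_iff_eq.2 h)]
      · rw [Equiv.swap_apply_of_ne_of_ne h (hπM y hyM)]
        exact ⟨.nil, by simp, by simp [walkCost_nil]⟩
    obtain ⟨q₁, hq₁, hc₁⟩ := first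
    obtain ⟨q₂, hq₂, hc₂⟩ := h4 y hyM
    obtain ⟨q₃, hq₃, hc₃⟩ := last
    have hx' : x = v ∨ x = y := by
      rcases Finset.mem_insert.1 hx with h | hx
      · exact Or.inl h
      · right
        rw [hy, Equiv.swap_apply_of_ne_of_ne (ne_of_mem_of_not_mem hx hu) (ne_of_mem_of_not_mem hx hv)]
    have hyU := hq₂ _ q₂.start_mem_support
    have hπyU := hq₂ _ q₂.end_mem_support
    rw [Equiv.Perm.mul_apply, Equiv.Perm.mul_apply, ← hy]
    refine ⟨(q₁.append q₂).append q₃, ?_, ?_⟩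
    · intro w hw
      rw [SimpleGraph.Walk.mem_support_append_iff, SimpleGraph.Walk.mem_support_append_iff] at hw
      rw [Finset.mem_insert]
      rcases hw with (hw | hw) | hw
      · rcases hq₁ w hw with rfl | rfl
        · rcases hx' with h | h
          · exact Or.inl h
          · exact Or.inr (h ▸ hyU)
        · exact Or.inr hyU
      · exact Or.inr (hq₂ w hw)
      · rcases hq₃ w hw with rfl | rfl
        · exact Or.inr hπyU
        · exact Or.inl rfl
    · dsimp only
      rw [walkCost_append, walkCost_append, add_comm (walkCost c q₁), ← hy]
      exact add_le_add (add_le_add hc₂ hc₁) hc₃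
  · rw [Finset.sum_add_distrib, Finset.sum_add_distrib]
    refine add_le_add (add_le_add ?_ ?_) ?_
    · refine le_trans (le_of_eq ?_) h5
      refine Finset.sum_bij (fun x _ => Equiv.swap u v x) hs (fun _ _ _ _ h => (Equiv.swap u v).injective h)
        (fun y hy => ⟨Equiv.swap u v y, hs' y hy, Equiv.swap_apply_self _ _ _⟩) (fun _ _ => rfl)
    · rw [Finset.sum_ite_eq']
      split_ifs <;> simp
    · simp_rw [Equiv.swap_apply_eq_iff]
      rw [Finset.sum_ite_eq']
      split_ifs <;> simp

/-- This is the doubled spanning tree argument. The set is grown by one vertex at a time along an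
edge, and the tours for all choices of marks are extended simultaneously. An added edge is used at
most twice, which matches its double count in `pairCost`. -/
theorem exists_hasTour [DecidableEq V] (c : Sym2 V → ℝ≥0) {K : SimpleGraph V} {U : Finset V}
    (hU : ConnectedOn K U) {M : Finset V} (hM : M ⊆ U) : HasTour c K U M (pairCost c K U) := by
  have base : ∀ {W M : Finset V}, M ⊆ W → M.card ≤ 1 → HasTour c K W M (pairCost c K W) := by
    intro W M hMW hM
    refine ⟨1, fun _ => 0, fun _ _ => rfl, fun x hx => hx, fun h => by omega, fun x hx => ?_, by simp⟩
    exact ⟨.nil, by simpa using hMW hx, by simp [walkCost]⟩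
  have key : ∀ n, n + 1 ≤ U.card → ∃ W ⊆ U, W.card = n + 1 ∧
      ∀ M ⊆ W, HasTour c K W M (pairCost c K W) := by
    intro n
    induction n with
    | zero =>
      intro h
      obtain ⟨a, ha⟩ := Finset.card_pos.1 h
      refine ⟨{a}, by simpa using ha, by simp, fun M hM => base hM ?_⟩
      simpa using Finset.card_le_card hM
    | succ n ih =>
      intro h
      obtain ⟨W, hWU, hWn, hW⟩ := ih (by omega)
      obtain ⟨u, hu, v, hv, hvW, huv⟩ := hU W (by exact_mod_cast hWU)
        (by rw [Finset.coe_nonempty, ← Finset.card_pos]; omega)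
        (by rw [Ne, Finset.coe_inj]; rintro rfl; omega)
      rw [Finset.mem_coe] at hu hv hvW
      refine ⟨insert v W, Finset.insert_subset hv hWU,
        by rw [Finset.card_insert_of_notMem hvW, hWn], fun M hM => ?_⟩
      have hcost := pairCost_insert_ge c hu hvW huv
      by_cases hvM : v ∈ M
      · obtain ⟨M', hM', hvM', rfl⟩ : ∃ M' ⊆ W, v ∉ M' ∧ M = insert v M' :=
          ⟨M.erase v, Finset.subset_insert_iff.1 hM, Finset.notMem_erase _ _,
            (Finset.insert_erase hvM).symm⟩
        by_cases huM : u ∈ M'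
        · exact ((hW M' hM').insert_of_mem huM hvM' hM' huv).mono subset_rfl hcost
        · exact ((hW (insert u M') (Finset.insert_subset hu hM')).replace huM hvM' hvW
            huv).mono subset_rfl hcost
      · refine (hW M fun x hx => ?_).mono (Finset.subset_insert _ _) (by
          refine le_trans ?_ hcost
          rw [add_assoc]; exact le_self_add)
        exact (Finset.mem_insert.1 (hM hx)).resolve_left fun h => hvM (h ▸ hx)
  rcases Nat.eq_zero_or_pos U.card with h | h
  · exact base hM ((Finset.card_le_card hM).trans (by omega))
  · obtain ⟨W, hWU, hWn, hW⟩ := key (U.card - 1) (by omega)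
    rw [← Finset.eq_of_subset_of_card_le hWU (by omega)] at hM ⊢
    exact hW M hM

/-! ### From disjoint paths to links -/

/-- The edges of `H` with both ends in `D`. -/
def innerGraph (H : SimpleGraph V) (D : Finset V) : SimpleGraph V where
  Adj u v := H.Adj u v ∧ u ∈ D ∧ v ∈ D
  symm := ⟨fun _ _ h => ⟨h.1.symm, h.2.2, h.2.1⟩⟩
  loopless := ⟨fun u h => H.loopless.irrefl u h.1⟩

/-- The edges of `H` with at most one end in `D`. -/
def outerGraph (H : SimpleGraph V) (D : Finset V) : SimpleGraph V where
  Adj u v := H.Adj u v ∧ ¬ (u ∈ D ∧ v ∈ D)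
  symm := ⟨fun _ _ h => ⟨h.1.symm, fun h' => h.2 h'.symm⟩⟩
  loopless := ⟨fun u h => H.loopless.irrefl u h.1⟩

/-- A path visits its first vertex only at the start and its last vertex only at the end, so a dart
from `t` to `r` is the whole path. -/
lemma eq_of_isPath_of_dart {H : SimpleGraph V} {t r : V} {p q : H.Walk t r} (hp : p.IsPath)
    (hq : q.IsPath) (h1 : ∃ d ∈ p.darts, d.fst = t ∧ d.snd = r)
    (h2 : ∃ d ∈ q.darts, d.fst = t ∧ d.snd = r) : p = q := by
  have key : ∀ {p : H.Walk t r} (h : H.Adj t r), p.IsPath → (∃ d ∈ p.darts, d.fst = t ∧ d.snd = r) →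
      p = .cons h .nil := by
    intro p h hp ⟨d, hd, hdt, hdr⟩
    cases p with
    | nil => simp at hd
    | cons h' p =>
      rw [SimpleGraph.Walk.cons_isPath_iff] at hp
      rw [SimpleGraph.Walk.darts_cons, List.mem_cons] at hd
      rcases hd with rfl | hd
      · dsimp only at hdr
        subst hdr
        rw [SimpleGraph.Walk.eq_nil_iff_nil.2 (SimpleGraph.Walk.isPath_iff_nil.1 hp.1)]
      · exact absurd (hdt ▸ p.dart_fst_mem_support_of_mem_darts hd) hp.2
  obtain ⟨d, hd, hdt, hdr⟩ := id h1
  have h : H.Adj t r := hdt ▸ hdr ▸ d.adj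
  rw [key h hp h1, key h hq h2]

/-- Each path leaves `A` along some dart, which is charged to its edge if both ends lie in `D` and
to its head otherwise. Two disjoint paths cannot share a head outside `D`, nor a dart unless it runs
from `t` to `r`, in which case they coincide. -/
lemma HasDisjointPaths.cutCondition [Fintype V] [DecidableEq V] {H : SimpleGraph V} {k : ℕ} {r : V}
    {S : Finset V} (hH : ∀ t ∈ S, HasDisjointPaths H k t r) :
    CutCondition (outerGraph H (insert r S)) (innerGraph H (insert r S)) k r S (insert r S) := by
  classical
  obtain ⟨D, hD⟩ : ∃ D, D = insert r S := ⟨_, rfl⟩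
  rw [← hD]
  intro A ⟨t, htS, htA⟩ hrA hAD
  have htD : t ∈ D := by rw [hD]; exact Finset.mem_insert_of_mem htS
  have hrD : r ∈ D := by rw [hD]; exact Finset.mem_insert_self _ _
  obtain ⟨P, hPk, hP, hPd⟩ := hH t htS
  have hex : ∀ p : H.Walk t r, ∃ d ∈ p.darts, d.fst ∈ A ∧ d.snd ∉ A := fun p =>
    p.exists_boundary_dart (A : Set V) htA hrA
  choose d hd hdA hdA' using hex
  obtain ⟨φ, hφ⟩ : ∃ φ : H.Walk t r → V ⊕ Sym2 V, φ = fun p =>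
    if (d p).fst ∈ D ∧ (d p).snd ∈ D then .inr s((d p).fst, (d p).snd) else .inl (d p).snd := ⟨_, rfl⟩
  rw [← hPk, ← Finset.card_disjSum]
  refine Finset.card_le_card_of_injOn φ (fun p hp => ?_) fun p hp q hq hpq => ?_
  · rw [Finset.mem_coe, hφ]
    dsimp only
    split_ifs with h
    · refine Finset.inr_mem_disjSum.2 (mem_crossing.2 ⟨⟨(d p).adj, h⟩, ?_⟩)
      exact ⟨⟨_, Sym2.mem_mk_left _ _, hdA p⟩, _, Sym2.mem_mk_right _ _, hdA' p⟩
    · refine Finset.inl_mem_disjSum.2 (mem_boundary.2 ⟨hdA' p, _, hdA p, (d p).adj, h⟩)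
  · rw [Finset.mem_coe] at hp hq
    by_contra hne
    have hdis := hPd p hp q hq hne
    rw [hφ] at hpq
    dsimp only at hpq
    split_ifs at hpq with h1 h2 h2
    · rw [Sum.inr.injEq, Sym2.eq_iff] at hpq
      obtain ⟨e1, e2⟩ := hpq.resolve_right fun h => hdA' q (h.1 ▸ hdA p)
      have m1 := hdis (d p).fst (p.dart_fst_mem_support_of_mem_darts (hd p))
        (e1 ▸ q.dart_fst_mem_support_of_mem_darts (hd q))
      have m2 := hdis (d p).snd (p.dart_snd_mem_support_of_mem_darts (hd p))
        (e2 ▸ q.dart_snd_mem_support_of_mem_darts (hd q))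
      have f1 := m1.1.resolve_right fun h => hrA (h ▸ hdA p)
      have f2 := m2.1.resolve_left fun h => hdA' p (h ▸ htA)
      exact hne (eq_of_isPath_of_dart (hP p hp) (hP q hq) ⟨_, hd p, f1, f2⟩
        ⟨_, hd q, e1 ▸ f1, e2 ▸ f2⟩)
    · rw [Sum.inl.injEq] at hpq
      have m2 := hdis (d p).snd (p.dart_snd_mem_support_of_mem_darts (hd p))
        (hpq ▸ q.dart_snd_mem_support_of_mem_darts (hd q))
      refine hAD (d p).snd (mem_boundary.2 ⟨hdA' p, _, hdA p, (d p).adj, h1⟩) ?_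
      rcases m2.1 with h | h
      · rwa [h]
      · rwa [h]

lemma card_crossing_singleton_le [Fintype V] [DecidableEq V] (F : SimpleGraph V)
    [DecidableRel F.Adj] (t : V) :
    (crossing F {t}).card ≤ (Finset.univ.filter fun s => F.Adj t s).card := by
  refine le_trans (Finset.card_le_card (t := (Finset.univ.filter fun s => F.Adj t s).image
    fun s => s(t, s)) fun z hz => ?_) Finset.card_image_le
  induction z with | _ a b =>
  obtain ⟨hab, ⟨u, hu, hut⟩, -⟩ := mem_crossing.1 hz
  rw [Finset.mem_singleton] at hut
  rw [Finset.mem_image]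
  rcases Sym2.mem_iff.1 hu with rfl | rfl
  · exact ⟨b, by simpa [← hut] using hab, by rw [hut]⟩
  · exact ⟨a, by simpa [← hut] using hab.symm, by rw [hut, Sym2.eq_swap]⟩

open Classical in
/-- The vertices of `D` that have a neighbour in `B`. -/
def feet (Q : SimpleGraph V) (D : Finset V) (B : Set V) : Finset V :=
  D.filter fun s => Touches Q s B

lemma mem_feet {Q : SimpleGraph V} {D : Finset V} {B : Set V} {s : V} :
    s ∈ feet Q D B ↔ s ∈ D ∧ Touches Q s B := by
  simp [feet]

open Classical in
/-- A blob together with its feet. -/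
def spider [Fintype V] (Q : SimpleGraph V) (D : Finset V) (g : V → V) (x : V) : Finset V :=
  Finset.univ.filter fun v => v ∈ blob D g x ∨ v ∈ feet Q D (blob D g x)

lemma mem_spider [Fintype V] {Q : SimpleGraph V} {D : Finset V} {g : V → V} {x v : V} :
    v ∈ spider Q D g x ↔ v ∈ blob D g x ∨ v ∈ feet Q D (blob D g x) := by
  simp [spider]

lemma ConnectedOn.spider [Fintype V] {Q : SimpleGraph V} {D : Finset V} {g : V → V} {x : V}
    (h : ConnectedOn Q (blob D g x)) : ConnectedOn Q (spider Q D g x : Set V) := by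
  intro W hW hne hWU
  by_cases hsub : blob D g x ⊆ W
  · obtain ⟨y, hy, hyW⟩ : ∃ y ∈ (SSConn.spider Q D g x : Set V), y ∉ W := by
      by_contra h
      push Not at h
      exact hWU (hW.antisymm h)
    rcases mem_spider.1 hy with h | h
    · exact absurd (hsub h) hyW
    · obtain ⟨-, v, hv, hyv⟩ := mem_feet.1 h
      exact ⟨v, hsub hv, y, hy, hyW, hyv.symm⟩
  · by_cases hemp : (W ∩ blob D g x).Nonempty
    · obtain ⟨u, hu, v, hv, hvW, huv⟩ := h _ Set.inter_subset_right hemp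
        fun h => hsub (Set.inter_eq_right.1 h)
      exact ⟨u, hu.1, v, mem_spider.2 (Or.inl hv), fun h => hvW ⟨h, hv⟩, huv⟩
    · obtain ⟨w, hw⟩ := hne
      rcases mem_spider.1 (hW hw) with h | h
      · exact absurd ⟨w, hw, h⟩ hemp
      · obtain ⟨-, v, hv, hwv⟩ := mem_feet.1 h
        exact ⟨w, hw, v, mem_spider.2 (Or.inl hv), fun h => hemp ⟨v, h, hv⟩, hwv⟩

/-- Spiders of distinct labels share no edge with each other or with the edges inside `D`. -/
lemma pairCost_add_sum_spider_le [Fintype V] (c : Sym2 V → ℝ≥0) (H : SimpleGraph V)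
    (D : Finset V) (g : V → V) :
    pairCost c (innerGraph H D) Finset.univ +
      ∑ x, pairCost c (outerGraph H D) (spider (outerGraph H D) D g x) ≤
      pairCost c H Finset.univ := by
  classical
  obtain ⟨Q, hQ⟩ : ∃ Q, Q = outerGraph H D := ⟨_, rfl⟩
  have e : ∀ x, pairCost c Q (spider Q D g x) = ∑ u, ∑ v,
      if u ∈ spider Q D g x ∧ v ∈ spider Q D g x ∧ Q.Adj u v then c s(u, v) else 0 := by
    intro x
    simp only [pairCost, ← Finset.sum_filter, Finset.sum_sigma']
    refine Finset.sum_congr ?_ fun _ _ => rfl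
    ext ⟨u, v⟩
    simp
  rw [← hQ]
  simp_rw [e]
  rw [Finset.sum_comm]
  simp_rw [Finset.sum_comm (s := Finset.univ (α := V)) (t := Finset.univ (α := V))
    (f := fun x v => if _ ∈ spider Q D g x ∧ v ∈ spider Q D g x ∧ Q.Adj _ v then c s(_, v) else 0)]
  rw [pairCost, pairCost, ← Finset.sum_add_distrib]
  refine Finset.sum_le_sum fun u _ => ?_
  rw [← Finset.sum_add_distrib]
  refine Finset.sum_le_sum fun v _ => ?_
  by_cases hH : H.Adj u v
  swap
  · rw [if_neg (fun h : (innerGraph H D).Adj u v => hH h.1), if_neg hH, zero_add]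
    refine (Finset.sum_eq_zero fun x _ => if_neg fun h => hH ?_).le
    have := h.2.2
    rw [hQ] at this
    exact this.1
  rw [if_pos hH]
  by_cases hD : u ∈ D ∧ v ∈ D
  · rw [if_pos (show (innerGraph H D).Adj u v from ⟨hH, hD⟩), Finset.sum_eq_zero, add_zero]
    refine fun x _ => if_neg fun h => ?_
    have := h.2.2
    rw [hQ] at this
    exact this.2 hD
  · rw [if_neg fun h : (innerGraph H D).Adj u v => hD h.2, zero_add]
    have hx : ∀ x w, w ∉ D → w ∈ spider Q D g x → x = g w := fun x w hw h => by
      rcases mem_spider.1 h with h | h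
      · exact h.2.symm
      · exact absurd (mem_feet.1 h).1 hw
    -- An end of the edge outside `D` determines the label of the only spider that can contain the
    -- edge.
    obtain ⟨y, hy⟩ : ∃ y, ∀ x, u ∈ spider Q D g x ∧ v ∈ spider Q D g x ∧ Q.Adj u v → x = y := by
      by_cases hu : u ∈ D
      · exact ⟨g v, fun x h => hx x v (fun h' => hD ⟨hu, h'⟩) h.2.1⟩
      · exact ⟨g u, fun x h => hx x u hu h.1⟩
    calc _ ≤ ∑ x, if x = y then c s(u, v) else 0 := by
          refine Finset.sum_le_sum fun x _ => ?_
          split_ifs with h1 h2 h2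
          · exact le_rfl
          · exact absurd (hy x h1) h2
          · exact zero_le
          · exact le_rfl
      _ ≤ _ := by simp

/-- The spider decomposition, in the form of `k` links for every `t ∈ S`: walks from `t` to other
vertices of `S ∪ {r}` that meet only in `S ∪ {r}`, the total cost of all of them being at most
twice the cost of `H`. -/
theorem exists_links [Fintype V] [DecidableEq V] (c : Sym2 V → ℝ≥0) {H : SimpleGraph V} {k : ℕ}
    {r : V} {S : Finset V} (hrS : r ∉ S) (hH : ∀ t ∈ S, HasDisjointPaths H k t r) :
    ∃ (Z : V → Fin k → Set V) (ω : V → Fin k → ℝ≥0) (K : V → Fin k → SimpleGraph V),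
      (∀ t ∈ S, (∀ i, K t i ≤ H ∧ ∃ b ∈ insert r S, b ≠ t ∧ ∃ q : (K t i).Walk t b,
          (∀ v ∈ q.support, v ∈ Z t i) ∧ walkCost c q ≤ ω t i) ∧
        ∀ i j, i ≠ j → (∀ v ∈ Z t i, v ∈ Z t j → v ∈ insert r S) ∧
          ¬ ((K t i).Adj t r ∧ (K t j).Adj t r)) ∧
      ∑ t ∈ S, ∑ i, ω t i ≤ pairCost c H Finset.univ := by
  classical
  have hcut := HasDisjointPaths.cutCondition hH
  obtain ⟨D, hD⟩ : ∃ D, D = insert r S := ⟨_, rfl⟩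
  rw [← hD] at hcut ⊢
  have hrD : r ∈ D := by rw [hD]; exact Finset.mem_insert_self _ _
  have hSD : S ⊆ D := by rw [hD]; exact Finset.subset_insert _ _
  obtain ⟨g, hg, hgS⟩ := hcut.exists_blobs hSD hrS hrD
    (fun u v (h : (innerGraph H D).Adj u v) => h.2.1)
    (fun u hu v hv (h : (outerGraph H D).Adj u v) => h.2 ⟨hu, hv⟩)
  have hcost := pairCost_add_sum_spider_le c H D g
  obtain ⟨Q, hQ⟩ : ∃ Q, Q = outerGraph H D := ⟨_, rfl⟩
  obtain ⟨F, hF⟩ : ∃ F, F = innerGraph H D := ⟨_, rfl⟩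
  rw [← hQ] at hg hcost
  rw [← hF] at hcost
  simp only [← hQ, ← hF] at hgS
  have htour : ∀ x, HasTour c Q (spider Q D g x) (feet Q D (blob D g x))
      (pairCost c Q (spider Q D g x)) := fun x =>
    exists_hasTour c (hg x).spider fun s hs => mem_spider.2 (Or.inr hs)
  choose π d hπ1 hπ2 hπ3 hπ4 hd using htour
  -- `k` distinct links are chosen for each `t ∈ S`: left summands are direct edges inside `D`,
  -- right summands are blobs. The value for `t ∉ S` is a dummy.
  have hemb : ∀ t, ∃ e : Fin k → V ⊕ V, t ∈ S → Function.Injective e ∧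
      ∀ i, e i ∈ (Finset.univ.filter fun s => F.Adj t s).disjSum (linkLabels Q D g t) := by
    intro t
    by_cases ht : t ∈ S
    · have hcard : k ≤ ((Finset.univ.filter fun s => F.Adj t s).disjSum (linkLabels Q D g t)).card := by
        rw [Finset.card_disjSum]
        have := card_crossing_singleton_le F t
        have := hgS t ht
        omega
      obtain ⟨f⟩ := Function.Embedding.nonempty_of_card_le (α := Fin k)
        (β := ((Finset.univ.filter fun s => F.Adj t s).disjSum (linkLabels Q D g t) :
          Finset (V ⊕ V))) (by simpa using hcard)
      exact ⟨fun i => (f i : V ⊕ V), fun _ => ⟨fun i j h => f.injective (Subtype.ext h),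
        fun i => (f i).2⟩⟩
    · exact ⟨fun _ => .inl t, fun h => absurd h ht⟩
  choose e he using hemb
  obtain ⟨ω, hω1, hω2⟩ : ∃ ω : V → V ⊕ V → ℝ≥0, (∀ t s, ω t (.inl s) = c s(t, s)) ∧
    ∀ t x, ω t (.inr x) = d x t :=
    ⟨fun t => Sum.elim (fun s => c s(t, s)) fun x => d x t, fun _ _ => rfl, fun _ _ => rfl⟩
  -- A direct link gets a graph with a single edge, while `Q` does not contain `tr`, both ends being
  -- in `D`. So at most one link of `t` has the edge `tr` at its disposal.
  refine ⟨fun t i => Sum.elim (fun s => {t, s}) (fun x => (spider Q D g x : Set V)) (e t i),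
    fun t i => ω t (e t i),
    fun t i => Sum.elim (fun s => SimpleGraph.fromEdgeSet {s(t, s)}) (fun _ => Q) (e t i),
    fun t ht => ⟨fun i => ?_, fun i j hij => ?_⟩, ?_⟩
  · have hi := (he t ht).2 i
    dsimp only
    generalize e t i = a at hi ⊢
    rcases a with s | x
    · rw [Finset.inl_mem_disjSum, Finset.mem_filter, hF] at hi
      obtain ⟨-, hts, -, hsD⟩ := hi
      simp only [Sum.elim_inl]
      refine ⟨?_, s, hsD, hts.ne', .cons (by simp [hts.ne]) .nil, by simp, ?_⟩
      · intro u v huv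
        rw [SimpleGraph.fromEdgeSet_adj, Set.mem_singleton_iff, Sym2.eq_iff] at huv
        rcases huv.1 with ⟨rfl, rfl⟩ | ⟨rfl, rfl⟩
        · exact hts
        · exact hts.symm
      · rw [walkCost_cons, walkCost_nil, add_zero, hω1]
    · rw [Finset.inr_mem_disjSum, mem_linkLabels] at hi
      simp only [Sum.elim_inr]
      have htf : t ∈ feet Q D (blob D g x) := mem_feet.2 ⟨hSD ht, hi.1⟩
      obtain ⟨s, hsD, hst, hs⟩ := hi.2
      have hsf : s ∈ feet Q D (blob D g x) := mem_feet.2 ⟨hsD, hs⟩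
      refine ⟨?_, π x t, (mem_feet.1 (hπ2 x t htf)).1,
        hπ3 x (Finset.one_lt_card.2 ⟨s, hsf, t, htf, hst⟩) t htf, ?_⟩
      · rw [hQ]; exact fun u v (h : (outerGraph H D).Adj u v) => h.1
      · rw [hω2]; exact hπ4 x t htf
  · have hi := (he t ht).2 i
    have hj := (he t ht).2 j
    have hne : e t i ≠ e t j := fun h => hij ((he t ht).1 h)
    have hQr : ¬ Q.Adj t r := by rw [hQ]; exact fun (h : (outerGraph H D).Adj t r) => h.2 ⟨hSD ht, hrD⟩
    have hspid : ∀ x v, v ∈ spider Q D g x → v ∉ D → g v = x := fun x v h hv => by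
      rcases mem_spider.1 h with h | h
      · exact h.2
      · exact absurd (mem_feet.1 h).1 hv
    have hpair : ∀ s, .inl s ∈ (Finset.univ.filter fun s => F.Adj t s).disjSum
        (linkLabels Q D g t) → ∀ v ∈ ({t, s} : Set V), v ∈ D := fun s hs v hv => by
      rw [Finset.inl_mem_disjSum, Finset.mem_filter, hF] at hs
      rcases hv with rfl | hv
      · exact hSD ht
      · rw [Set.mem_singleton_iff.1 hv]; exact hs.2.2.2
    dsimp only
    generalize e t i = a at *
    generalize e t j = b at *
    rcases a with s | x
    · refine ⟨fun v hv _ => hpair s hi v hv, ?_⟩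
      rcases b with s' | y
      · rintro ⟨h1, h2⟩
        simp only [Sum.elim_inl, SimpleGraph.fromEdgeSet_adj, Set.mem_singleton_iff] at h1 h2
        apply hne
        rw [← Sym2.congr_right.1 h1.1, ← Sym2.congr_right.1 h2.1]
      · exact fun h => hQr h.2
    · refine ⟨fun v hv hv' => ?_, fun h => hQr h.1⟩
      rcases b with s' | y
      · exact hpair s' hj v hv'
      · by_contra hvD
        exact hne (by rw [← hspid x v hv hvD, ← hspid y v hv' hvD])
  · refine le_trans ?_ hcost
    have h1 : ∀ t ∈ S, ∑ i, ω t (e t i) ≤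
        (∑ s, if F.Adj t s then c s(t, s) else 0) + ∑ x ∈ linkLabels Q D g t, d x t := by
      intro t ht
      calc ∑ i, ω t (e t i) = ∑ a ∈ Finset.univ.image (e t), ω t a :=
            (Finset.sum_image fun i _ j _ h => (he t ht).1 h).symm
        _ ≤ ∑ a ∈ (Finset.univ.filter fun s => F.Adj t s).disjSum (linkLabels Q D g t), ω t a :=
            Finset.sum_le_sum_of_subset fun a ha => by
              obtain ⟨i, -, rfl⟩ := Finset.mem_image.1 ha
              exact (he t ht).2 i
        _ = _ := by
            rw [Finset.sum_disjSum, Finset.sum_filter]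
            simp_rw [hω1, hω2]
    refine (Finset.sum_le_sum h1).trans ?_
    rw [Finset.sum_add_distrib]
    refine add_le_add ?_ ?_
    · rw [pairCost]
      exact Finset.sum_le_sum_of_subset (Finset.subset_univ _)
    · have : ∀ t, ∑ x ∈ linkLabels Q D g t, d x t =
          ∑ x, if x ∈ linkLabels Q D g t then d x t else 0 := fun t => by
        rw [Finset.sum_ite_mem, Finset.univ_inter]
      simp_rw [this]
      rw [Finset.sum_comm]
      refine Finset.sum_le_sum fun x _ => le_trans ?_ (hd x)
      rw [← Finset.sum_filter]
      refine Finset.sum_le_sum_of_subset fun t ht => ?_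
      rw [Finset.mem_filter, mem_linkLabels] at ht
      exact mem_feet.2 ⟨hSD ht.1, ht.2.1⟩

/-! ### The assignment problem and Birkhoff rounding -/

/-- The arcs of the assignment problem for `k` disjoint paths from `t` to `B`, where `r ∈ B`: the
`i`-th path leaves `t` at the node `i` and is closed to a cycle through this node. The node `r` is
used only by a path that consists of the edge `tr`; any other path to `r` is closed at its last
vertex before `r`. Unused vertices are fixed points. -/
def Arc (G : SimpleGraph V) (k : ℕ) (t r : V) (B : Finset V) : V ⊕ Fin k → V ⊕ Fin k → Prop
  | .inl u, .inl v => u = v ∨ (u ≠ t ∧ v ≠ t ∧ u ∉ B ∧ v ≠ r ∧ G.Adj u v)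
  | .inr _, .inl v => G.Adj t v
  | .inl u, .inr _ => u ∈ B ∨ (u ≠ t ∧ G.Adj u r)
  | .inr _, .inr _ => False

open Classical in
/-- The costs of the assignment problem for `k` disjoint paths from `t` to `B`. -/
def arcCost (c : Sym2 V → ℝ≥0) (k : ℕ) (t r : V) (B : Finset V) : V ⊕ Fin k → V ⊕ Fin k → ℝ≥0
  | .inl u, .inl v => if u = v then 0 else c s(u, v)
  | .inr _, .inl v => c s(t, v)
  | .inl u, .inr _ => if u ∈ B then 0 else c s(u, r)
  | .inr _, .inr _ => 0

/-- The cost of a permutation in the assignment problem. -/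
def permCost [Fintype V] (c : Sym2 V → ℝ≥0) {k : ℕ} (t r : V) (B : Finset V)
    (σ : Equiv.Perm (V ⊕ Fin k)) : ℝ≥0 :=
  ∑ x, arcCost c k t r B x (σ x)

lemma arcCost_self (c : Sym2 V → ℝ≥0) {k : ℕ} {t r : V} {B : Finset V} (x : V ⊕ Fin k) :
    arcCost c k t r B x x = 0 := by
  rcases x with v | i <;> simp [arcCost]

/-- Birkhoff's theorem for an assignment problem with costs `w` and permitted arcs `A`. -/
lemma exists_perm_of_mem_doublyStochastic {X : Type*} [Fintype X] [DecidableEq X]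
    {A : X → X → Prop} (w : X → X → ℝ) {M : Matrix X X ℝ} (hM : M ∈ doublyStochastic ℝ X)
    (hA : ∀ x y, M x y ≠ 0 → A x y) :
    ∃ σ : Equiv.Perm X, (∀ x, A x (σ x)) ∧ ∑ x, w x (σ x) ≤ ∑ x, ∑ y, M x y * w x y := by
  obtain ⟨a, ha, ha1, haM⟩ := exists_eq_sum_perm_of_mem_doublyStochastic hM
  have hMa : ∀ x y, M x y = ∑ σ, a σ * if σ x = y then 1 else 0 := fun x y => by
    rw [← haM, Matrix.sum_apply]
    refine Finset.sum_congr rfl fun σ _ => ?_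
    rw [Matrix.smul_apply, smul_eq_mul, Equiv.Perm.permMatrix, PEquiv.toMatrix_apply]
    simp [eq_comm]
  have hsum : ∑ x, ∑ y, M x y * w x y = ∑ σ, a σ * ∑ x, w x (σ x) := by
    simp_rw [Finset.mul_sum]
    rw [Finset.sum_comm (s := (Finset.univ : Finset (Equiv.Perm X)))]
    refine Finset.sum_congr rfl fun x _ => ?_
    simp_rw [hMa, Finset.sum_mul]
    rw [Finset.sum_comm]
    refine Finset.sum_congr rfl fun σ _ => ?_
    simp
  by_contra hcon
  push Not at hcon
  -- Every permutation in the Birkhoff combination uses only permitted arcs. If all of them were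
  -- more expensive than the average, so would be the average itself.
  have hlt : ∀ σ, a σ ≠ 0 → ∑ x, ∑ y, M x y * w x y < ∑ x, w x (σ x) := fun σ hσ => by
    refine hcon σ fun x => hA _ _ ?_
    rw [hMa]
    have h0 : 0 < a σ := (ha σ).lt_of_ne' hσ
    refine (lt_of_lt_of_le ?_ (Finset.single_le_sum
      (f := fun τ : Equiv.Perm X => a τ * if τ x = σ x then (1 : ℝ) else 0)
      (fun τ _ => mul_nonneg (ha τ) (by split_ifs <;> norm_num)) (Finset.mem_univ σ))).ne'
    simpa using h0
  obtain ⟨σ₀, hσ₀⟩ : ∃ σ, a σ ≠ 0 := by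
    by_contra h
    push Not at h
    simp [h] at ha1
  have : ∑ σ, a σ * ∑ x, ∑ y, M x y * w x y < ∑ σ, a σ * ∑ x, w x (σ x) := by
    refine Finset.sum_lt_sum (fun σ _ => ?_) ⟨σ₀, Finset.mem_univ _,
      mul_lt_mul_of_pos_left (hlt σ₀ hσ₀) ((ha σ₀).lt_of_ne' hσ₀)⟩
    by_cases h : a σ = 0
    · simp [h]
    · exact mul_le_mul_of_nonneg_left (hlt σ h).le (ha σ)
  rw [← hsum, ← Finset.sum_mul, ha1, one_mul] at this
  exact lt_irrefl _ this

/-- `τ i` is the cycle of a path that leaves `t` at the node `i`. -/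
structure IsPathPerm (G : SimpleGraph V) {k : ℕ} (t r : V) (B : Finset V) (i : Fin k)
    (τ : Equiv.Perm (V ⊕ Fin k)) : Prop where
  arc : ∀ x, τ x ≠ x → Arc G k t r B x (τ x)
  moves : τ (.inr i) ≠ .inr i
  fixes : ∀ j, j ≠ i → τ (.inr j) = .inr j

lemma card_filter_fixed_ge {X : Type*} [DecidableEq X] {k : ℕ} (τ : Fin k → Equiv.Perm X) (x : X)
    (h : ∀ i j, i ≠ j → τ i x = x ∨ τ j x = x) :
    (k : ℝ) - 1 ≤ ∑ i, if τ i x = x then (1 : ℝ) else 0 := by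
  have h1 : (Finset.univ.filter fun i => ¬ τ i x = x).card ≤ 1 := by
    refine Finset.card_le_one.2 fun i hi j hj => ?_
    by_contra hij
    exact (h i j hij).elim (Finset.mem_filter.1 hi).2 (Finset.mem_filter.1 hj).2
  have h2 := Finset.card_filter_add_card_filter_not (s := (Finset.univ : Finset (Fin k)))
    (fun i => τ i x = x)
  rw [Finset.card_univ, Fintype.card_fin] at h2
  rw [Finset.sum_boole, sub_le_iff_le_add]
  exact_mod_cast (show k ≤ _ + 1 by omega)

/-- A combination of a valid permutation `σ`, which fixes `W`, and the cycles of `k` paths that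
meet only in `W` can be rounded to a valid permutation. -/
lemma exists_perm_of_combination [Fintype V] [DecidableEq V] (c : Sym2 V → ℝ≥0) {G : SimpleGraph V}
    {k : ℕ} {t r : V} {B W : Finset V} {τ : Fin k → Equiv.Perm (V ⊕ Fin k)}
    (hτ : ∀ i, IsPathPerm G t r B i (τ i))
    (hτW : ∀ i j, i ≠ j → ∀ v ∉ W, τ i (.inl v) = .inl v ∨ τ j (.inl v) = .inl v)
    {N : ℕ} {σ : Equiv.Perm (V ⊕ Fin k)} (hσ : N ≠ 0 → ∀ x, Arc G k t r B x (σ x))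
    (hσW : ∀ v ∈ W, σ (.inl v) = .inl v) (hN : W.Nonempty → k ≤ N) :
    ∃ ρ : Equiv.Perm (V ⊕ Fin k), (∀ x, Arc G k t r B x (ρ x)) ∧
      (N + 1) * permCost c t r B ρ ≤ N * permCost c t r B σ + ∑ i, permCost c t r B (τ i) := by
  classical
  -- Rows and columns sum to `(N + k - (k - 1)) / (N + 1) = 1`. The subtracted identity costs
  -- nothing, since fixed points are free.
  obtain ⟨M, hM⟩ : ∃ M : Matrix (V ⊕ Fin k) (V ⊕ Fin k) ℝ, ∀ x y, M x y =
      ((N : ℝ) * (if σ x = y then 1 else 0) + ∑ i, (if τ i x = y then (1 : ℝ) else 0) -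
        (k - 1) * if x = y then 1 else 0) / (N + 1) := ⟨Matrix.of fun x y => _, fun _ _ => rfl⟩
  have hN1 : (0 : ℝ) < N + 1 := by positivity
  have hfix : ∀ i j : Fin k, τ j (.inr i) = .inr i ↔ j ≠ i := fun i j =>
    ⟨fun h e => (hτ j).moves (e ▸ h), fun h => (hτ j).fixes i h.symm⟩
  -- A starting node may not be a fixed point. Exactly `k - 1` of the cycles fix it, and the
  -- subtracted term removes precisely this amount.
  have hinr : ∀ i : Fin k, M (.inr i) (.inr i) = 0 := by
    intro i
    have h1 : (N : ℝ) * (if σ (.inr i) = .inr i then 1 else 0) = 0 := by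
      by_cases h : N = 0
      · simp [h]
      · rw [if_neg, mul_zero]
        intro h'
        have := hσ h (.inr i)
        rw [h'] at this
        exact this
    have h2 : ∑ j, (if τ j (.inr i) = .inr i then (1 : ℝ) else 0) = k - 1 := by
      simp_rw [hfix]
      rw [Finset.sum_boole, Finset.filter_ne', Finset.card_erase_of_mem (Finset.mem_univ _),
        Finset.card_univ, Fintype.card_fin, Nat.cast_sub (by have := i.2; omega), Nat.cast_one]
    rw [hM, h1, h2, if_pos rfl]
    ring
  have hnn : ∀ x y, 0 ≤ M x y := by
    intro x y
    have hs : 0 ≤ ∑ i, (if τ i x = y then (1 : ℝ) else 0) :=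
      Finset.sum_nonneg fun i _ => by split_ifs <;> norm_num
    have h1 : 0 ≤ (N : ℝ) * (if σ x = y then 1 else 0) := by positivity
    by_cases hxy : x = y
    · subst hxy
      rcases x with v | i
      · rw [hM]
        refine div_nonneg ?_ hN1.le
        rw [if_pos rfl, mul_one, sub_nonneg]
        -- On `W` the cycles may collide, but there the `N ≥ k` copies of `σ` suffice; off `W` at
        -- least `k - 1` of the cycles fix `v`.
        by_cases hv : v ∈ W
        · rw [if_pos (hσW v hv), mul_one]
          have : (k : ℝ) ≤ N := by exact_mod_cast hN ⟨v, hv⟩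
          linarith
        · have := card_filter_fixed_ge τ (.inl v) fun i j hij => hτW i j hij v hv
          linarith
      · rw [hinr]
    · rw [hM, if_neg hxy]
      refine div_nonneg ?_ hN1.le
      linarith
  have hrow : ∀ x, ∑ y, M x y = 1 := by
    intro x
    simp_rw [hM]
    rw [← Finset.sum_div, Finset.sum_sub_distrib, Finset.sum_add_distrib, ← Finset.mul_sum,
      ← Finset.mul_sum, Finset.sum_comm]
    simp
    field_simp
    ring
  have hcol : ∀ y, ∑ x, M x y = 1 := by
    intro y
    have e : ∀ f : Equiv.Perm (V ⊕ Fin k), ∑ x, (if f x = y then (1 : ℝ) else 0) = 1 := fun f => by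
      rw [Fintype.sum_equiv f _ (fun z => if z = y then (1 : ℝ) else 0) fun _ => rfl]
      simp
    simp_rw [hM]
    rw [← Finset.sum_div, Finset.sum_sub_distrib, Finset.sum_add_distrib, ← Finset.mul_sum,
      ← Finset.mul_sum, Finset.sum_comm]
    simp_rw [e]
    simp
    field_simp
    ring
  have hA : ∀ x y, M x y ≠ 0 → Arc G k t r B x y := by
    intro x y h
    by_cases hxy : x = y
    · subst hxy
      rcases x with v | i
      · exact Or.inl rfl
      · exact absurd (hinr i) h
    · by_contra hArc
      apply h
      have h1 : (N : ℝ) * (if σ x = y then 1 else 0) = 0 := by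
        by_cases h0 : N = 0
        · simp [h0]
        · rw [if_neg, mul_zero]
          rintro rfl
          exact hArc (hσ h0 x)
      rw [hM, h1, if_neg hxy, Finset.sum_eq_zero]
      · simp
      · intro i _
        refine if_neg ?_
        rintro rfl
        exact hArc ((hτ i).arc x (Ne.symm hxy))
  obtain ⟨ρ, hρ, hcost⟩ := exists_perm_of_mem_doublyStochastic
    (fun x y => (arcCost c k t r B x y : ℝ))
    (mem_doublyStochastic_iff_sum.2 ⟨hnn, hrow, hcol⟩) hA
  refine ⟨ρ, hρ, ?_⟩
  have e : ∑ x, ∑ y, M x y * (arcCost c k t r B x y : ℝ) =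
      (N * (permCost c t r B σ : ℝ) + ∑ i, (permCost c t r B (τ i) : ℝ)) / (N + 1) := by
    simp only [permCost, NNReal.coe_sum]
    rw [Finset.sum_comm (s := Finset.univ (α := Fin k)), Finset.mul_sum, ← Finset.sum_add_distrib,
      Finset.sum_div]
    refine Finset.sum_congr rfl fun x _ => ?_
    simp_rw [hM, div_mul_eq_mul_div, sub_mul, add_mul, Finset.sum_mul]
    rw [← Finset.sum_div, Finset.sum_sub_distrib, Finset.sum_add_distrib, Finset.sum_comm]
    simp [arcCost_self]
  rw [e, le_div_iff₀ hN1] at hcost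
  rw [← NNReal.coe_le_coe]
  push_cast [permCost] at hcost ⊢
  linarith

/-! ### Cycles from walks -/

/-- A walk that ends in `B` can be shortened to a path that meets `B` only at its end. -/
lemma exists_isPath_of_walk (c : Sym2 V → ℝ≥0) {K : SimpleGraph V} {B : Finset V} {u b : V}
    (q : K.Walk u b) (hb : b ∈ B) : ∃ b' ∈ B, ∃ p : K.Walk u b', p.IsPath ∧
      (∀ v ∈ p.support, v ∈ q.support) ∧ (∀ v ∈ p.support, v ∈ B → v = b') ∧
      walkCost c p ≤ walkCost c q := by
  classical
  induction q with
  | nil => exact ⟨_, hb, .nil, by simp, by simp, by simp, le_rfl⟩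
  | @cons u w b h q ih =>
    by_cases hu : u ∈ B
    · exact ⟨u, hu, .nil, by simp, by simp, by simp, by simp [walkCost_nil]⟩
    · obtain ⟨b', hb', p, hp, hsub, hB, hc⟩ := ih hb
      have hc' : walkCost c p ≤ walkCost c (.cons h q) := by
        rw [walkCost_cons]; exact hc.trans le_add_self
      by_cases hup : u ∈ p.support
      · refine ⟨b', hb', p.dropUntil u hup, hp.dropUntil hup, fun v hv => ?_, fun v hv => ?_, ?_⟩
        · rw [SimpleGraph.Walk.support_cons]
          exact List.mem_cons_of_mem _ (hsub v (p.support_dropUntil_subset_support hup hv))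
        · exact hB v (p.support_dropUntil_subset_support hup hv)
        · refine le_trans ?_ hc'
          conv_rhs => rw [← p.take_spec hup, walkCost_append]
          exact le_add_self
      · refine ⟨b', hb', .cons h p, hp.cons hup, fun v hv => ?_, fun v hv hvB => ?_, ?_⟩
        · rw [SimpleGraph.Walk.support_cons, List.mem_cons] at hv ⊢
          exact hv.imp_right (hsub v)
        · rw [SimpleGraph.Walk.support_cons, List.mem_cons] at hv
          rcases hv with rfl | hv
          · exact absurd hvB hu
          · exact hB v hv hvB
        · rw [walkCost_cons, walkCost_cons]
          exact add_le_add_right hc _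

section

variable [Fintype V] [DecidableEq V]

/-- The cycle is built backwards along the path, always closed through the node `.inr i`. The cost
of that node's own arc is left out, because the edge from `t` is added only at the end. -/
lemma exists_perm_of_isPath_aux (c : Sym2 V → ℝ≥0) {G K : SimpleGraph V} (hK : K ≤ G) {k : ℕ}
    {t r : V} {B : Finset V} (i : Fin k) {v b : V} (p : K.Walk v b) (hp : p.IsPath)
    (hb : b ∈ B) (hB : ∀ w ∈ p.support, w ∈ B → w = b) (ht : t ∉ p.support) (hvr : v ≠ r) :
    ∃ τ : Equiv.Perm (V ⊕ Fin k), τ (.inr i) = .inl v ∧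
      (∀ x, x ≠ .inr i → τ x ≠ x → Arc G k t r B x (τ x)) ∧
      (∀ j, j ≠ i → τ (.inr j) = .inr j) ∧
      (∀ w, τ (.inl w) ≠ .inl w → w ∈ p.support ∧ w ≠ r) ∧
      ∑ x ∈ Finset.univ.erase (.inr i), arcCost c k t r B x (τ x) ≤ walkCost c p := by
  -- the case that the path is closed at its first vertex
  have swap : ∀ {v b : V} (p : K.Walk v b), v ≠ r → Arc G k t r B (.inl v) (.inr i) →
      arcCost c k t r B (.inl v) (.inr i) ≤ walkCost c p →
      ∃ τ : Equiv.Perm (V ⊕ Fin k), τ (.inr i) = .inl v ∧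
      (∀ x, x ≠ .inr i → τ x ≠ x → Arc G k t r B x (τ x)) ∧
      (∀ j, j ≠ i → τ (.inr j) = .inr j) ∧
      (∀ w, τ (.inl w) ≠ .inl w → w ∈ p.support ∧ w ≠ r) ∧
      ∑ x ∈ Finset.univ.erase (.inr i), arcCost c k t r B x (τ x) ≤ walkCost c p := by
    intro v b p hvr harc hcost
    have hne : ∀ x, x ≠ .inr i → x ≠ .inl v → Equiv.swap (.inr i) (.inl v : V ⊕ Fin k) x = x :=
      fun x => Equiv.swap_apply_of_ne_of_ne
    refine ⟨Equiv.swap (.inr i) (.inl v), Equiv.swap_apply_left _ _, fun x hx hx' => ?_,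
      fun j hj => hne _ (by simpa using hj) (by simp), fun w hw => ?_, ?_⟩
    · obtain rfl : x = .inl v := by
        by_contra h
        exact hx' (hne x hx h)
      rw [Equiv.swap_apply_right]
      exact harc
    · obtain rfl : w = v := by
        by_contra h
        exact hw (hne _ (by simp) (by simpa using h))
      exact ⟨p.start_mem_support, hvr⟩
    · rw [Finset.sum_eq_single (.inl v)]
      · rwa [Equiv.swap_apply_right]
      · intro x hx hxv
        rw [hne x (Finset.ne_of_mem_erase hx) hxv, arcCost_self]
      · simp
  induction p with
  | nil => exact swap .nil hvr (Or.inl hb) (by simp [arcCost, hb])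
  | @cons v w b h p ih =>
    have hvt : v ≠ t := fun e => ht (by simp [e])
    rw [SimpleGraph.Walk.cons_isPath_iff] at hp
    have hvB : v ∉ B := fun h' => hp.2 (hB v (by simp) h' ▸ p.end_mem_support)
    by_cases hwr : w = r
    · refine swap _ hvr (Or.inr ⟨hvt, hwr ▸ hK h⟩) ?_
      have e : c s(v, w) = c s(v, r) := by rw [hwr]
      rw [walkCost_cons, e]
      simp [arcCost, hvB]
    · obtain ⟨τ, h1, h2, h3, h4, h5⟩ := ih hp.1 hb
        (fun x hx hxB => hB x (by simp [hx]) hxB) (fun h' => ht (by simp [h'])) hwr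
      have hwt : w ≠ t := fun e => ht (by simp [← e])
      have hτv : τ (.inl v) = .inl v := by
        by_contra h'
        exact hp.2 (h4 v h').1
      have hne : ∀ x, x ≠ .inr i → x ≠ .inl v →
          (τ * Equiv.swap (.inr i) (.inl v : V ⊕ Fin k)) x = τ x := fun x hx hx' => by
        rw [Equiv.Perm.mul_apply, Equiv.swap_apply_of_ne_of_ne hx hx']
      have hv' : (τ * Equiv.swap (.inr i) (.inl v : V ⊕ Fin k)) (.inl v) = .inl w := by
        rw [Equiv.Perm.mul_apply, Equiv.swap_apply_right, h1]
      have harc : Arc G k t r B (.inl v) (.inl w) := Or.inr ⟨hvt, hwt, hvB, hwr, hK h⟩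
      -- Composing with the swap inserts `v` between `.inr i` and `w`.
      refine ⟨τ * Equiv.swap (.inr i) (.inl v), ?_, fun x hx hx' => ?_, fun j hj => ?_,
        fun x hx => ?_, ?_⟩
      · rw [Equiv.Perm.mul_apply, Equiv.swap_apply_left, hτv]
      · by_cases hxv : x = .inl v
        · rw [hxv, hv']
          exact harc
        · rw [hne x hx hxv] at hx' ⊢
          exact h2 x hx hx'
      · rw [hne _ (by simpa using hj) (by simp), h3 j hj]
      · by_cases hxv : x = v
        · rw [hxv]
          exact ⟨by simp, hvr⟩
        · rw [hne _ (by simp) (by simpa using hxv)] at hx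
          exact ⟨by simp [(h4 x hx).1], (h4 x hx).2⟩
      · have hmem : (.inl v : V ⊕ Fin k) ∈ Finset.univ.erase (.inr i) := by simp
        rw [← Finset.add_sum_erase _ _ hmem, hv', walkCost_cons]
        refine add_le_add (by simp [arcCost, h.ne]) (le_trans ?_ h5)
        rw [← Finset.add_sum_erase _ _ hmem, hτv, arcCost_self, zero_add]
        refine (Finset.sum_congr rfl fun x hx => ?_).le
        rw [Finset.mem_erase, Finset.mem_erase] at hx
        rw [hne x hx.2.1 hx.1]

/-- The cycle of a walk from `t` to `B`. -/
lemma exists_isPathPerm_of_walk (c : Sym2 V → ℝ≥0) {G K : SimpleGraph V} (hK : K ≤ G) {k : ℕ}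
    {t r : V} {B : Finset V} (hr : r ∈ B) (ht : t ∉ B) (i : Fin k) {b : V} (hb : b ∈ B)
    (q : K.Walk t b) :
    ∃ τ : Equiv.Perm (V ⊕ Fin k), IsPathPerm G t r B i τ ∧
      (∀ v, τ (.inl v) ≠ .inl v → v ∈ q.support ∧ v ≠ t ∧ (v = r → K.Adj t r)) ∧
      permCost c t r B τ ≤ walkCost c q := by
  obtain ⟨b', hb', p, hp, hsub, hB, hc⟩ := exists_isPath_of_walk c q hb
  have main : ∃ τ : Equiv.Perm (V ⊕ Fin k), IsPathPerm G t r B i τ ∧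
      (∀ v, τ (.inl v) ≠ .inl v → v ∈ p.support ∧ v ≠ t ∧ (v = r → K.Adj t r)) ∧
      permCost c t r B τ ≤ walkCost c p := by
    cases p with
    | nil => exact absurd hb' ht
    | @cons _ v _ h p =>
      rw [SimpleGraph.Walk.cons_isPath_iff] at hp
      -- The one-edge path `tr` is the only case in which the node `r` is moved.
      by_cases hvr : v = r
      · subst hvr
        have hne : ∀ x, x ≠ .inr i → x ≠ .inl v → Equiv.swap (.inr i) (.inl v : V ⊕ Fin k) x = x :=
          fun x => Equiv.swap_apply_of_ne_of_ne
        refine ⟨Equiv.swap (.inr i) (.inl v), ⟨fun x hx => ?_, by simp,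
          fun j hj => hne _ (by simpa using hj) (by simp)⟩, fun w hw => ?_, ?_⟩
        · by_cases hxi : x = .inr i
          · rw [hxi, Equiv.swap_apply_left]
            exact hK h
          · obtain rfl : x = .inl v := by
              by_contra h'
              exact hx (hne x hxi h')
            rw [Equiv.swap_apply_right]
            exact Or.inl hr
        · obtain rfl : w = v := by
            by_contra h'
            exact hw (hne _ (by simp) (by simpa using h'))
          exact ⟨by simp, h.ne', fun _ => h⟩
        · rw [permCost, ← Finset.add_sum_erase _ _ (Finset.mem_univ (.inr i : V ⊕ Fin k)),
            Finset.sum_eq_zero, add_zero, walkCost_cons, Equiv.swap_apply_left]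
          · exact le_self_add
          · intro x hx
            by_cases hxv : x = .inl v
            · rw [hxv, Equiv.swap_apply_right]
              simp [arcCost, hr]
            · rw [hne x (Finset.ne_of_mem_erase hx) hxv, arcCost_self]
      · obtain ⟨τ, h1, h2, h3, h4, h5⟩ := exists_perm_of_isPath_aux c hK i p hp.1 hb'
          (fun x hx hxB => hB x (by simp [hx]) hxB) hp.2 hvr
        refine ⟨τ, ⟨fun x hx => ?_, by simp [h1], h3⟩, fun w hw => ?_, ?_⟩
        · by_cases hxi : x = .inr i
          · rw [hxi, h1]
            exact hK h
          · exact h2 x hxi hx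
        · refine ⟨by simp [(h4 w hw).1], ?_, fun e => absurd e (h4 w hw).2⟩
          rintro rfl
          exact hp.2 (h4 w hw).1
        · rw [permCost, ← Finset.add_sum_erase _ _ (Finset.mem_univ (.inr i : V ⊕ Fin k)),
            walkCost_cons, h1]
          exact add_le_add_right h5 _
  obtain ⟨τ, h1, h2, h3⟩ := main
  exact ⟨τ, h1, fun v hv => ⟨hsub v (h2 v hv).1, (h2 v hv).2⟩, h3.trans hc⟩

end

/-! ### Augmentations from permutations -/

/-- Following a valid permutation from a vertex until it returns to a starting node gives a path
to `B`. -/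
lemma exists_isPath_of_perm (c : Sym2 V → ℝ≥0) {G : SimpleGraph V} {k : ℕ}
    {t r : V} {B : Finset V} (hr : r ∈ B) (ht : t ∉ B) {σ : Equiv.Perm (V ⊕ Fin k)}
    (hσ : ∀ x, Arc G k t r B x (σ x)) (n : ℕ) : ∀ v, v ≠ t →
      (∀ m ≤ n, ((σ ^ m) (.inl v)).isLeft) → ((σ ^ (n + 1)) (.inl v)).isRight →
      ∃ b ∈ B, ∃ p : G.Walk v b, p.IsPath ∧ t ∉ p.support ∧
        (∀ w ∈ p.support, w = r ∨ ∃ m ≤ n, (σ ^ m) (.inl v) = .inl w) ∧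
        (r ∈ p.support → b = r) ∧
        walkCost c p ≤ ∑ m ∈ Finset.range (n + 1),
          arcCost c k t r B ((σ ^ m) (.inl v)) ((σ ^ (m + 1)) (.inl v)) := by
  have hrt : t ≠ r := fun h => ht (h ▸ hr)
  induction n with
  | zero =>
    intro v hvt _ hright
    by_cases hvB : v ∈ B
    · refine ⟨v, hvB, .nil, by simp, by simpa using hvt.symm, fun w hw => Or.inr ⟨0, le_rfl, ?_⟩,
        by simp [eq_comm], by simp [walkCost_nil]⟩
      rw [SimpleGraph.Walk.support_nil, List.mem_singleton] at hw
      rw [hw, pow_zero, Equiv.Perm.one_apply]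
    · obtain ⟨j, hj⟩ := Sum.isRight_iff.1 hright
      rw [zero_add, pow_one] at hj
      have harc := hσ (.inl v)
      rw [hj] at harc
      obtain ⟨-, hadj⟩ := Or.resolve_left harc hvB
      refine ⟨r, hr, .cons hadj .nil, by simp [hadj.ne], by simp [hvt.symm, hrt],
        fun w hw => ?_, fun _ => rfl, ?_⟩
      · simp only [SimpleGraph.Walk.support_cons, SimpleGraph.Walk.support_nil, List.mem_cons,
          List.not_mem_nil, or_false] at hw
        rcases hw with rfl | rfl
        · exact Or.inr ⟨0, le_rfl, rfl⟩
        · exact Or.inl rfl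
      · rw [Finset.sum_range_one, zero_add, pow_one, hj, walkCost_cons, walkCost_nil]
        simp [arcCost, hvB]
  | succ n ih =>
    intro v hvt hleft hright
    obtain ⟨v', hv'⟩ := Sum.isLeft_iff.1 (hleft 1 (by omega))
    rw [pow_one] at hv'
    have hpow : ∀ m, (σ ^ (m + 1)) (.inl v) = (σ ^ m) (.inl v') := fun m => by
      rw [pow_succ, Equiv.Perm.mul_apply, hv']
    -- A return to `v` before the first starting node would make the orbit periodic, so no starting
    -- node could be reached.
    have hper : ∀ m, m ≤ n → (σ ^ (m + 1)) (.inl v) ≠ .inl v := fun m hm h => by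
      have h1 := hleft (n + 1 - m) (by omega)
      have h2 : (σ ^ (n + 1 + 1)) (.inl v) = (σ ^ (n + 1 - m)) (.inl v) := by
        rw [show n + 1 + 1 = (n + 1 - m) + (m + 1) by omega, pow_add, Equiv.Perm.mul_apply, h]
      rw [h2] at hright
      rw [← Sum.not_isLeft] at hright
      simp [h1] at hright
    have hvv' : v ≠ v' := fun h => hper 0 (by omega) (by rw [zero_add, pow_one, hv', h])
    have harc := hσ (.inl v)
    rw [hv'] at harc
    obtain ⟨-, hv't, hvB, hv'r, hadj⟩ := Or.resolve_left harc hvv'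
    obtain ⟨b, hb, p, hp, htp, hsup, hrp, hc⟩ := ih v' hv't
      (fun m hm => hpow m ▸ hleft (m + 1) (by omega)) (hpow (n + 1) ▸ hright)
    have hvp : v ∉ p.support := fun h => by
      rcases hsup v h with rfl | ⟨m, hm, h⟩
      · exact hvB hr
      · exact hper m hm (by rw [hpow, h])
    refine ⟨b, hb, .cons hadj p, hp.cons hvp, ?_, fun w hw => ?_, fun h => hrp ?_, ?_⟩
    · simp [htp, hvt.symm]
    · rw [SimpleGraph.Walk.support_cons, List.mem_cons] at hw
      rcases hw with rfl | hw
      · exact Or.inr ⟨0, by omega, rfl⟩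
      · refine (hsup w hw).imp_right ?_
        rintro ⟨m, hm, h⟩
        exact ⟨m + 1, by omega, by rw [hpow, h]⟩
    · rw [SimpleGraph.Walk.support_cons, List.mem_cons] at h
      exact h.resolve_left fun h => hvB (h ▸ hr)
    · rw [Finset.sum_range_succ', walkCost_cons, add_comm]
      refine add_le_add ?_ ?_
      · simpa only [hpow] using hc
      · rw [pow_zero, zero_add, pow_one, Equiv.Perm.one_apply, hv']
        simp [arcCost, hvv']

/-- A valid permutation gives an augmentation that costs no more. -/
theorem augCost_le_permCost [Fintype V] [DecidableEq V] (c : Sym2 V → ℝ≥0) {G : SimpleGraph V}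
    {k : ℕ} {t r : V} {T' : Finset V} (hr : r ∉ T') (ht : t ∉ insert r T')
    {σ : Equiv.Perm (V ⊕ Fin k)} (hσ : ∀ x, Arc G k t r (insert r T') x (σ x)) :
    augCost G c k r T' t ≤ permCost c t r (insert r T') σ := by
  classical
  obtain ⟨B, hB⟩ : ∃ B, B = insert r T' := ⟨_, rfl⟩
  rw [← hB] at ht hσ ⊢
  have hrB : r ∈ B := by rw [hB]; exact Finset.mem_insert_self _ _
  have htr : t ≠ r := fun h => ht (h ▸ hrB)
  -- the length of the cycle through a starting node, up to the next starting node
  have hex : ∀ i : Fin k, ∃ n, ((σ ^ (n + 1)) (.inr i)).isRight := fun i =>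
    ⟨orderOf σ - 1, by
      rw [Nat.sub_add_cancel (orderOf_pos σ), pow_orderOf_eq_one]; rfl⟩
  have hlen : ∀ i : Fin k, ∃ n, ((σ ^ (n + 1)) (.inr i)).isRight ∧
      ∀ m < n, ((σ ^ (m + 1)) (.inr i)).isLeft := fun i =>
    ⟨Nat.find (hex i), Nat.find_spec (hex i), fun m hm => by
      have := Nat.find_min (hex i) hm
      simpa using this⟩
  choose n hn hn' using hlen
  -- The orbit segments from one starting node up to the next are pairwise disjoint, even if several
  -- of them belong to the same cycle of `σ`.
  have hinj : ∀ {i j : Fin k} {m m' : ℕ}, m ≤ n i → m' ≤ n j →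
      (σ ^ m) (.inr i) = (σ ^ m') (.inr j) → i = j ∧ m = m' := by
    have key : ∀ {i j : Fin k} {m m' : ℕ}, m ≤ m' → m' ≤ n j →
        (σ ^ m) (.inr i) = (σ ^ m') (.inr j) → i = j ∧ m = m' := by
      intro i j m m' hmm hm' h
      rw [show m' = m + (m' - m) by omega, pow_add, Equiv.Perm.mul_apply] at h
      have h := (σ ^ m).injective h
      rcases Nat.eq_zero_or_pos (m' - m) with h0 | h0
      · rw [h0] at h
        exact ⟨by simpa using h, by omega⟩
      · have := hn' j (m' - m - 1) (by omega)
        rw [show m' - m - 1 + 1 = m' - m by omega, ← h] at this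
        simp at this
    intro i j m m' hm hm' h
    rcases le_total m m' with h' | h'
    · exact key h' hm' h
    · exact ⟨(key h' hm h.symm).1.symm, (key h' hm h.symm).2.symm⟩
  -- The second vertex is recorded because it distinguishes the paths: they may have the same
  -- endpoint `r`, but `σ` is injective on the starting nodes.
  have hpath : ∀ i : Fin k, ∃ b ∈ B, ∃ p : G.Walk t b, p.IsPath ∧
      .inl (p.getVert 1) = σ (.inr i) ∧
      (∀ w ∈ p.support, w = t ∨ w = r ∨ ∃ m ≤ n i, (σ ^ m) (.inr i) = .inl w) ∧
      (r ∈ p.support → b = r) ∧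
      walkCost c p ≤ ∑ m ∈ Finset.range (n i + 1),
          arcCost c k t r B ((σ ^ m) (.inr i)) ((σ ^ (m + 1)) (.inr i)) := by
    intro i
    have harc := hσ (.inr i)
    obtain ⟨v, hv⟩ : ∃ v, σ (.inr i) = .inl v := by
      rcases h : σ (.inr i) with v | j
      · exact ⟨v, rfl⟩
      · rw [h] at harc
        exact harc.elim
    rw [hv] at harc
    have hadj : G.Adj t v := harc
    have hpow : ∀ m, (σ ^ (m + 1)) (.inr i) = (σ ^ m) (.inl v) := fun m => by
      rw [pow_succ, Equiv.Perm.mul_apply, hv]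
    have hn0 : n i ≠ 0 := fun h => by
      have := hn i
      rw [h, hpow] at this
      simp at this
    obtain ⟨l, hl⟩ := Nat.exists_eq_succ_of_ne_zero hn0
    obtain ⟨b, hb, p, hp, htp, hsup, hrp, hc⟩ := exists_isPath_of_perm c hrB ht hσ l v hadj.ne'
      (fun m hm => by rw [← hpow]; exact hn' i m (by omega))
      (by have := hn i; rwa [hl, Nat.succ_eq_add_one, hpow] at this)
    refine ⟨b, hb, .cons hadj p, hp.cons htp, by simp [hv], fun w hw => ?_, fun h => hrp ?_, ?_⟩
    · rw [SimpleGraph.Walk.support_cons, List.mem_cons] at hw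
      refine hw.imp_right fun hw => (hsup w hw).imp_right ?_
      rintro ⟨m, hm, h⟩
      exact ⟨m + 1, by omega, by rw [hpow, h]⟩
    · rw [SimpleGraph.Walk.support_cons, List.mem_cons] at h
      exact h.resolve_left htr.symm
    · rw [Finset.sum_range_succ', walkCost_cons, add_comm, hl]
      refine add_le_add ?_ ?_
      · simpa only [hpow] using hc
      · rw [pow_zero, zero_add, pow_one, Equiv.Perm.one_apply, hv]
        simp [arcCost]
  choose b hb p hp hp1 hsup hrp hc using hpath
  have hcommon : ∀ {i j : Fin k} {w : V}, w ∈ (p i).support → w ∈ (p j).support → w ≠ t → w ≠ r →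
      i = j := by
    intro i j w hi hj hwt hwr
    obtain ⟨m, hm, h⟩ := ((hsup i w hi).resolve_left hwt).resolve_left hwr
    obtain ⟨m', hm', h'⟩ := ((hsup j w hj).resolve_left hwt).resolve_left hwr
    exact (hinj hm hm' (h.trans h'.symm)).1
  have hPinj : Function.Injective fun i => (⟨b i, p i⟩ : Σ v : V, G.Walk t v) := by
    intro i j hij
    have : (p i).getVert 1 = (p j).getVert 1 :=
      congrArg (fun x : Σ v : V, G.Walk t v => x.2.getVert 1) hij
    have h2 : σ (.inr i) = σ (.inr j) := by rw [← hp1, ← hp1, this]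
    simpa using σ.injective h2
  have haug : IsAugmentation G k r T' t
      (Finset.univ.image fun i => (⟨b i, p i⟩ : Σ v : V, G.Walk t v)) := by
    constructor
    · rw [Finset.card_image_of_injective _ hPinj, Finset.card_univ, Fintype.card_fin]
    · simp only [Finset.mem_image, Finset.mem_univ, true_and]
      rintro _ ⟨i, rfl⟩
      exact hp i
    · simp only [Finset.mem_image, Finset.mem_univ, true_and]
      rintro _ ⟨i, rfl⟩
      have := hb i
      rw [hB, Finset.mem_insert] at this
      exact this.symm
    · simp only [Finset.mem_image, Finset.mem_univ, true_and]
      rintro _ ⟨i, rfl⟩ _ ⟨j, rfl⟩ hij w hwi hwj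
      by_cases hwt : w = t
      · exact ⟨Or.inl hwt, Or.inl hwt⟩
      by_cases hwr : w = r
      · subst hwr
        exact ⟨Or.inr (hrp i hwi).symm, Or.inr (hrp j hwj).symm⟩
      · exact absurd (by rw [hcommon hwi hwj hwt hwr]) hij
    · simp only [Finset.mem_image, Finset.mem_univ, true_and]
      rintro _ ⟨i, rfl⟩ _ ⟨j, rfl⟩ hiT hij
      dsimp only at hiT hij
      have hbr : b i ≠ r := fun h => hr (h ▸ hiT)
      have hbt : b i ≠ t := fun h => ht (h ▸ hb i)
      have hmem : ∀ v, v = b j → v ∈ (p j).support := fun v h => h ▸ (p j).end_mem_support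
      rw [hcommon (p i).end_mem_support (hmem _ hij) hbt hbr]
  refine (iInf₂_le _ haug).trans ?_
  rw [ENNReal.coe_le_coe, Finset.sum_image fun i _ j _ h => hPinj h]
  refine (Finset.sum_le_sum fun i _ => hc i).trans ?_
  rw [Finset.sum_sigma']
  simp only [pow_succ', Equiv.Perm.mul_apply]
  -- The segments consist of distinct nodes, so their arcs form a part of the cost of `σ`.
  rw [permCost, ← Finset.sum_image (s := Finset.univ.sigma fun i => Finset.range (n i + 1))
    (f := fun x => arcCost c k t r B x (σ x)) (g := fun a => (σ ^ a.2) (.inr a.1))]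
  · exact Finset.sum_le_sum_of_subset (Finset.subset_univ _)
  · rintro ⟨i, m⟩ hi ⟨j, m'⟩ hj h
    simp only [Finset.coe_sigma, Set.mem_sigma_iff, Finset.mem_coe, Finset.mem_range] at hi hj
    obtain ⟨rfl, rfl⟩ := hinj (Nat.lt_succ_iff.1 hi.2) (Nat.lt_succ_iff.1 hj.2) h
    rfl

/-! ### Colouring and the final estimate -/

lemma pairCost_univ [Fintype V] (c : Sym2 V → ℝ≥0) (H : SimpleGraph V) :
    pairCost c H Finset.univ = 2 * graphCost c H := by
  classical
  have h1 : pairCost c H Finset.univ =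
      ∑ a ∈ (Finset.univ : Finset (V × V)).filter fun a => H.Adj a.1 a.2, c s(a.1, a.2) := by
    rw [pairCost, Finset.sum_filter, ← Finset.univ_product_univ, Finset.sum_product]
  rw [h1, graphCost, Finset.mul_sum, ← Finset.sum_fiberwise_of_maps_to (t := H.edgeFinset)
    (g := fun a : V × V => s(a.1, a.2)) (fun a ha => by simpa using ha)]
  refine Finset.sum_congr rfl fun z hz => ?_
  induction z with | _ a b =>
  have hab : H.Adj a b := by simpa using hz
  have : (((Finset.univ : Finset (V × V)).filter fun a => H.Adj a.1 a.2).filter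
      fun x => s(x.1, x.2) = s(a, b)) = {(a, b), (b, a)} := by
    ext ⟨u, v⟩
    simp only [Finset.mem_filter, Finset.mem_univ, true_and, Finset.mem_insert,
      Finset.mem_singleton, Prod.mk.injEq, Sym2.eq_iff]
    constructor
    · exact fun h => h.2
    · rintro (⟨rfl, rfl⟩ | ⟨rfl, rfl⟩)
      · exact ⟨hab, Or.inl ⟨rfl, rfl⟩⟩
      · exact ⟨hab.symm, Or.inr ⟨rfl, rfl⟩⟩
  rw [this, Finset.sum_pair (by simp [hab.ne])]
  dsimp only
  rw [Sym2.eq_swap (a := b), two_mul]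

/-- A digraph with all out-degrees at most `k` is `(2k + 1)`-colourable. -/
lemma exists_coloring [DecidableEq V] (R : V → V → Prop) [DecidableRel R] {k : ℕ} (T : Finset V)
    (hk : ∀ t ∈ T, (T.filter fun s => s ≠ t ∧ R t s).card ≤ k) :
    ∃ f : V → Fin (2 * k + 1), ∀ s ∈ T, ∀ t ∈ T, s ≠ t → f s = f t → ¬ R s t := by
  induction hn : T.card generalizing T with
  | zero =>
    rw [Finset.card_eq_zero] at hn
    subst hn
    exact ⟨fun _ => 0, by simp⟩
  | succ n ih =>
    -- The in-degrees and the out-degrees have the same sum, so some vertex has in-degree at most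
    -- `k`, hence at most `2k` neighbours. It is coloured last.
    obtain ⟨v, hv, hvk⟩ : ∃ v ∈ T, (T.filter fun s => s ≠ v ∧ R s v).card ≤ k := by
      refine Finset.exists_le_of_sum_le (Finset.card_pos.1 (by omega)) ?_
      refine le_trans (le_of_eq ?_) (Finset.sum_le_sum hk)
      simp_rw [Finset.card_filter]
      rw [Finset.sum_comm]
      simp_rw [ne_comm]
    obtain ⟨f, hf⟩ := ih (T.erase v) (fun t ht => le_trans (Finset.card_le_card
      (Finset.filter_subset_filter _ (Finset.erase_subset _ _))) (hk t (Finset.mem_of_mem_erase ht)))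
      (by rw [Finset.card_erase_of_mem hv, hn]; rfl)
    obtain ⟨a, -, ha⟩ := Finset.exists_mem_notMem_of_card_lt_card
      (s := ((T.filter fun s => s ≠ v ∧ R v s) ∪ T.filter fun s => s ≠ v ∧ R s v).image f)
      (t := Finset.univ) (by
        refine lt_of_le_of_lt (Finset.card_image_le.trans (Finset.card_union_le _ _)) ?_
        have := hk v hv
        rw [Finset.card_univ, Fintype.card_fin]
        omega)
    have ha' : ∀ s ∈ T, s ≠ v → f s = a → ¬ R v s ∧ ¬ R s v := fun s hs hsv hfs => by
      constructor <;> intro hR <;> refine ha (Finset.mem_image.2 ⟨s, ?_, hfs⟩) <;>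
        simp [hs, hsv, hR]
    refine ⟨Function.update f v a, fun s hs t ht hst hfst => ?_⟩
    by_cases hsv : s = v
    · subst hsv
      rw [Function.update_self, Function.update_of_ne hst.symm] at hfst
      exact (ha' t ht hst.symm hfst.symm).1
    · by_cases htv : t = v
      · subst htv
        rw [Function.update_self, Function.update_of_ne hst] at hfst
        exact (ha' s hs hst hfst).2
      · rw [Function.update_of_ne hsv, Function.update_of_ne htv] at hfst
        exact hf s (Finset.mem_erase.2 ⟨hsv, hs⟩) t (Finset.mem_erase.2 ⟨htv, ht⟩) hst hfst

/-- The links of the spider decomposition as cycles in the assignment problems. -/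
lemma exists_pathPerms [Fintype V] [DecidableEq V] (c : Sym2 V → ℝ≥0) {G H : SimpleGraph V}
    {k : ℕ} {r : V} {T S : Finset V} (hr : r ∉ T) (hH : IsFeasible G k r T H) (hST : S ⊆ T) :
    ∃ τ : V → Fin k → Equiv.Perm (V ⊕ Fin k),
      (∀ t ∈ S, (∀ i, IsPathPerm G t r (insert r (T.erase t)) i (τ t i)) ∧
        ∀ i j, i ≠ j → ∀ v ∉ S.erase t, τ t i (.inl v) = .inl v ∨ τ t j (.inl v) = .inl v) ∧
      ∑ t ∈ S, ∑ i, permCost c t r (insert r (T.erase t)) (τ t i) ≤ 2 * graphCost c H := by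
  obtain ⟨Z, ω, K, hlink, hcost⟩ := exists_links c (fun h => hr (hST h))
    fun t ht => hH.2 t (hST ht)
  have hτ : ∀ t (i : Fin k), ∃ τ : Equiv.Perm (V ⊕ Fin k), t ∈ S →
      IsPathPerm G t r (insert r (T.erase t)) i τ ∧
      (∀ v, τ (.inl v) ≠ .inl v → v ∈ Z t i ∧ v ≠ t ∧ (v = r → (K t i).Adj t r)) ∧
      permCost c t r (insert r (T.erase t)) τ ≤ ω t i := by
    intro t i
    by_cases ht : t ∈ S
    · obtain ⟨hK, b, hb, hbt, q, hq, hqc⟩ := (hlink t ht).1 i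
      have htr : t ≠ r := fun h => hr (h ▸ hST ht)
      obtain ⟨τ, h1, h2, h3⟩ := exists_isPathPerm_of_walk c (hK.trans hH.1) (k := k)
        (B := insert r (T.erase t)) (Finset.mem_insert_self _ _) (by simp [htr]) i (b := b) (by
          rw [Finset.mem_insert] at hb ⊢
          exact hb.imp_right fun h => Finset.mem_erase.2 ⟨hbt, hST h⟩) q
      exact ⟨τ, fun _ => ⟨h1, fun v hv => ⟨hq v (h2 v hv).1, (h2 v hv).2⟩, h3.trans hqc⟩⟩
    · exact ⟨1, fun h => absurd h ht⟩
  choose τ hτ using hτ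
  refine ⟨τ, fun t ht => ⟨fun i => (hτ t i ht).1, fun i j hij v hv => ?_⟩, ?_⟩
  · by_contra hcon
    rw [not_or] at hcon
    obtain ⟨h1, h2, h3⟩ := (hτ t i ht).2.1 v hcon.1
    obtain ⟨h4, -, h5⟩ := (hτ t j ht).2.1 v hcon.2
    obtain ⟨h6, h7⟩ := (hlink t ht).2 i j hij
    -- Two links may meet in `D` only. A collision at `r` would require both to use the edge `tr`,
    -- so only `S \ {t}` remains.
    rcases Finset.mem_insert.1 (h6 v h1 h4) with h | h
    · exact h7 ⟨h3 h, h5 h⟩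
    · exact hv (Finset.mem_erase.2 ⟨h2, h⟩)
  · rw [← pairCost_univ]
    refine le_trans ?_ hcost
    exact Finset.sum_le_sum fun t ht => Finset.sum_le_sum fun i _ => (hτ t i ht).2.2

/-- The links must be taken with respect to a single colour class: collisions in the class are then
harmless, because the optimal permutations fix its other members. The factor `2k + 1` is the number
of classes. -/
theorem sum_augCost_le_of_isFeasible [Fintype V] [DecidableEq V] {G H : SimpleGraph V}
    (c : Sym2 V → ℝ≥0) {k : ℕ} {r : V} {T : Finset V} (hr : r ∉ T) (hH : IsFeasible G k r T H) :
    ∑ t ∈ T, augCost G c k r (T.erase t) t ≤ (2 * k + 1) * (2 * (graphCost c H : ℝ≥0∞)) := by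
  classical
  have hopt : ∀ t, ∃ σ : Equiv.Perm (V ⊕ Fin k), t ∈ T →
      (∀ x, Arc G k t r (insert r (T.erase t)) x (σ x)) ∧
      ∀ ρ : Equiv.Perm (V ⊕ Fin k), (∀ x, Arc G k t r (insert r (T.erase t)) x (ρ x)) →
        permCost c t r (insert r (T.erase t)) σ ≤ permCost c t r (insert r (T.erase t)) ρ := by
    intro t
    by_cases ht : t ∈ T
    · obtain ⟨τ, hτ, -⟩ := exists_pathPerms c hr hH (S := {t}) (by simpa using ht)
      obtain ⟨h1, h2⟩ := hτ t (by simp)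
      -- For `S = {t}` the cycles do not collide at all, so they combine to a valid permutation
      -- without any help (`N = 0`). This makes the set of candidates nonempty.
      obtain ⟨ρ, hρ, -⟩ := exists_perm_of_combination c h1 (W := ∅)
        (fun i j hij v _ => h2 i j hij v (by simp)) (N := 0) (σ := 1) (by simp) (by simp) (by simp)
      obtain ⟨σ, hσ, hmin⟩ := Finset.exists_min_image
        (Finset.univ.filter fun ρ : Equiv.Perm (V ⊕ Fin k) =>
          ∀ x, Arc G k t r (insert r (T.erase t)) x (ρ x))
        (permCost c t r (insert r (T.erase t))) ⟨ρ, by simpa using hρ⟩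
      exact ⟨σ, fun _ => ⟨by simpa using hσ, fun ρ hρ => hmin ρ (by simpa using hρ)⟩⟩
    · exact ⟨1, fun h => absurd h ht⟩
  choose σ hσ using hopt
  -- A terminal other than `t` that is moved can only be sent to a starting node, of which there are
  -- `k`.
  have hdeg : ∀ t ∈ T, (T.filter fun s => s ≠ t ∧ σ t (.inl s) ≠ .inl s).card ≤ k := by
    intro t ht
    have hj : ∀ s ∈ T.filter (fun s => s ≠ t ∧ σ t (.inl s) ≠ .inl s),
        ∃ j : Fin k, σ t (.inl s) = .inr j := by
      intro s hs
      rw [Finset.mem_filter] at hs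
      have harc := (hσ t ht).1 (.inl s)
      rcases h : σ t (.inl s) with v | j
      · rw [h] at harc
        rcases harc with rfl | h'
        · exact absurd h hs.2.2
        · exact absurd (by simp [hs.1, hs.2.1]) h'.2.2.1
      · exact ⟨j, rfl⟩
    calc _ ≤ ((Finset.univ : Finset (Fin k)).map Function.Embedding.inr :
          Finset (V ⊕ Fin k)).card := by
          refine Finset.card_le_card_of_injOn (fun s => σ t (.inl s)) (fun s hs => ?_)
            fun s _ s' _ h => Sum.inl_injective ((σ t).injective h)
          obtain ⟨j, hj⟩ := hj s hs
          simp [hj]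
      _ = k := by simp
  obtain ⟨f, hf⟩ := exists_coloring (fun t s => σ t (.inl s) ≠ .inl s) T hdeg
  have hclass : ∀ a, ∑ t ∈ T.filter (fun t => f t = a),
      permCost c t r (insert r (T.erase t)) (σ t) ≤ 2 * graphCost c H := by
    intro a
    obtain ⟨τ, hτ, hcost⟩ := exists_pathPerms c hr hH (S := T.filter fun t => f t = a)
      (Finset.filter_subset _ _)
    refine le_trans (Finset.sum_le_sum fun t ht => ?_) hcost
    obtain ⟨htT, hta⟩ := Finset.mem_filter.1 ht
    obtain ⟨hvalid, hmin⟩ := hσ t htT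
    obtain ⟨ρ, hρ, hle⟩ := exists_perm_of_combination c (hτ t ht).1 (hτ t ht).2 (N := k)
      (fun _ => hvalid) (fun v hv => by
        rw [Finset.mem_erase, Finset.mem_filter] at hv
        by_contra h
        exact hf t htT v hv.2.1 hv.1.symm (hta.trans hv.2.2.symm) h) fun _ => le_rfl
    -- Since `σ t` is no more expensive than `ρ`, `k` copies of its cost cancel and only the cost of
    -- the links remains.
    have h1 : (k + 1 : ℝ≥0) * permCost c t r (insert r (T.erase t)) (σ t) ≤ _ :=
      (mul_le_mul_right (hmin ρ hρ) _).trans hle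
    rw [add_mul, one_mul] at h1
    exact le_of_add_le_add_left h1
  calc ∑ t ∈ T, augCost G c k r (T.erase t) t
      ≤ ∑ t ∈ T, (permCost c t r (insert r (T.erase t)) (σ t) : ℝ≥0∞) :=
        Finset.sum_le_sum fun t ht => augCost_le_permCost c (fun h => hr (Finset.mem_of_mem_erase h))
          (by
            have : t ≠ r := fun h => hr (h ▸ ht)
            simp [this]) (hσ t ht).1
    _ = ((∑ a, ∑ t ∈ T.filter (fun t => f t = a),
          permCost c t r (insert r (T.erase t)) (σ t) : ℝ≥0) : ℝ≥0∞) := by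
        rw [Finset.sum_fiberwise, ENNReal.ofNNReal_finsetSum]
    _ ≤ ((∑ _a : Fin (2 * k + 1), 2 * graphCost c H : ℝ≥0) : ℝ≥0∞) :=
        ENNReal.coe_le_coe.2 (Finset.sum_le_sum fun a _ => hclass a)
    _ = _ := by
        simp

lemma augCost_zero (G : SimpleGraph V) (c : Sym2 V → ℝ≥0) (r : V) (T' : Finset V) (t : V) :
    augCost G c 0 r T' t = 0 := by
  refine le_antisymm ((iInf₂_le ∅ ⟨rfl, ?_, ?_, ?_, ?_⟩).trans (by simp)) zero_le <;> simp

end SSConn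

end

theorem mainTheorem6 {V : Type*} [Fintype V] [DecidableEq V] (G : SimpleGraph V)
    (c : Sym2 V → ℝ≥0) (k : ℕ) (r : V) (T : Finset V) (hr : r ∉ T) :
    ∑ t ∈ T, SSConn.augCost G c k r (T.erase t) t ≤
      8 * (k : ℝ≥0∞) * SSConn.optCost G c k r T := by
  -- For `k = 0` the estimate `(2k + 1) * 2 ≤ 8 * k` fails, but then the empty augmentation is free.
  rcases Nat.eq_zero_or_pos k with rfl | hk
  · simp [SSConn.augCost_zero]
  rw [SSConn.optCost, ENNReal.mul_iInf_of_ne (by simp; omega)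
    (ENNReal.mul_ne_top (by simp) (by simp))]
  refine le_iInf fun H => ?_
  rw [ENNReal.mul_iInf_of_ne (by simp; omega) (ENNReal.mul_ne_top (by simp) (by simp))]
  refine le_iInf fun hH => (SSConn.sum_augCost_le_of_isFeasible c hr hH).trans ?_
  rw [← mul_assoc]
  refine mul_le_mul' ?_ le_rfl
  have : (2 * k + 1) * 2 ≤ 8 * k := by omega
  exact_mod_cast this
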